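/- Let $d\ge 1$, let $\Omega\subset\mathbb R^d$ be open, bounded and connected, and let $\zeta,\beta:\mathbb R\to\mathbb R$ be continuous and non-decreasing with $\zeta(0)=\beta(0)=0$, such that $|\zeta(s)|\ge M_0|s|-M_1$ and $|\beta(s)|\le K_0|s|+K_1$ for all $s\in\mathbb R$, for some constants $M_0,M_1,K_0,K_1>0$, and such that $\beta+\zeta$ is strictly increasing (hence a bijection of $\mathbb R$). Let $\Lambda:\Omega\to\mathcal M_d(\mathbb R)$ be measurable and such that, for some $\overline\lambda\ge\underline\lambda>0$ and a.e. $x\in\Omega$, $\Lambda(x)$ is symmetric with eigenvalues in $[\underline\lambda,\overline\lambda]$, and let $f\in L^2(\Omega)$. Set $$\mu(t)=\zeta\big((\beta+\zeta)^{-1}(t)\big),\qquad \rho(t)=t-\mu(t),\qquad \nu(s)=\int_0^s\sqrt{\mu'(r)}\,dr .$$ Let $(V_m)_{m\in\mathbb N}$ be finite-dimensional subspaces of $H^1_0(\Omega)$ such that $\lim_{m\to\infty}\inf_{v\in V_m}\|\varphi-v\|_{H^1_0(\Omega)}=0$ for all $\varphi\in H^1_0(\Omega)$. Consider the problem: find $\overline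 w\in L^2(\Omega)$ such that $\mu(\overline w)\in H^1_0(\Omega)$ and $$\int_\Omega\rho(\overline w)v+\int_\Omega\Lambda\nabla\mu(\overline w)\cdot\nabla v=\int_\Omega f v\qquad\forall v\in H^1_0(\Omega),\tag{P}$$ and its conforming approximations: find $w_m\in V_m$ such that (with $\mu(w_m)\in H^1_0(\Omega)$) $$\int_\Omega\rho(w_m)v+\int_\Omega\Lambda\nabla\mu(w_m)\cdot\nabla v=\int_\Omega f v\qquad\forall v\in V_m.\tag{P$_m$}$$ Then (P$_m$) has at least one solution for every $m\in\mathbb N$, and (P) has exactly one solution $\overline w$. If $w_m$ is, for each $m$, any solution of (P$_m$), then $\mu(w_m),\mu(\overline w),\nu(w_m),\nu(\overline w)$ belong to $H^1_0(\Omega)$, $\rho(w_m),\rho(\overline w)$ belong to $L^2(\Omega)$ and, as $m\to\infty$, $\mu(w_m)\to\mu(\overline w)$ and $\nu(w_m)\to\nu(\overline w)$, in both cases weakly in $H^1_0(\Omega)$ and strongly in $L^2(\Omega)$, and $\rho(w_m)\to\rho(\overline w)$ weakly in $L^2(\Omega)$. Moreover, if the energy equality $$\int_\Omega\rho(\overline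 w)\overline w+\int_\Omega\Lambda\nabla\nu(\overline w)\cdot\nabla\nu(\overline w)=\int_\Omega f\overline w$$ holds, then $\nabla\nu(w_m)\to\nabla\nu(\overline w)$ strongly in $L^2(\Omega)^d$ and $w_m\to\overline w$ strongly in $L^2(\Omega)$. -/

import Mathlib

open MeasureTheory Filter Topology
open scoped ContDiff

noncomputable section

namespace DegenElliptic

/-- `ℝ^d` with its Euclidean structure. -/
abbrev Space (d : ℕ) := EuclideanSpace ℝ (Fin d)

/-- `L²(Ω)`. -/
abbrev L2 {d : ℕ} (Ω : Set (Space d)) := Lp ℝ 2 (volume.restrict Ω)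

/-- `L²(Ω)^d`. -/
abbrev L2Vec {d : ℕ} (Ω : Set (Space d)) := Lp (Space d) 2 (volume.restrict Ω)

/-- Test functions: smooth functions with compact support contained in `Ω`. -/
structure IsTest {d : ℕ} (Ω : Set (Space d)) (φ : Space d → ℝ) : Prop where
  smooth : ContDiff ℝ ∞ φ
  compact : HasCompactSupport φ
  supp : tsupport φ ⊆ Ω

/-- The pairs `(φ, ∇φ)`, `φ` a test function, as a subspace of the Hilbert space
`L²(Ω) × L²(Ω)^d`, whose norm is `‖(u, g)‖² = ‖u‖² + ‖g‖²`. -/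
def testPairs {d : ℕ} (Ω : Set (Space d)) : Submodule ℝ (WithLp 2 (L2 Ω × L2Vec Ω)) where
  carrier := {U | ∃ φ : Space d → ℝ, IsTest Ω φ ∧
    (U.fst : Space d → ℝ) =ᵐ[volume.restrict Ω] φ ∧
    (U.snd : Space d → Space d) =ᵐ[volume.restrict Ω] gradient φ}
  zero_mem' := by
    refine ⟨0, ⟨contDiff_const, HasCompactSupport.zero, by simp [tsupport]⟩,
      Lp.coeFn_zero _ _ _, ?_⟩
    have h : gradient (0 : Space d → ℝ) = 0 := by
      ext1 x
      exact gradient_fun_const x 0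
    rw [h]
    exact Lp.coeFn_zero _ _ _
  add_mem' := by
    rintro U W ⟨φ, hφ, h1, h2⟩ ⟨ψ, hψ, h3, h4⟩
    refine ⟨φ + ψ, ⟨hφ.smooth.add hψ.smooth, hφ.compact.add hψ.compact,
      (tsupport_add φ ψ).trans (Set.union_subset hφ.supp hψ.supp)⟩, ?_, ?_⟩
    · exact (Lp.coeFn_add U.fst W.fst).trans (h1.add h3)
    · have h : gradient (φ + ψ) = gradient φ + gradient ψ := by
        ext1 x
        simp only [gradient, Pi.add_apply]
        rw [fderiv_add (hφ.smooth.differentiable (by simp) x)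
          (hψ.smooth.differentiable (by simp) x), map_add]
      rw [h]
      exact (Lp.coeFn_add U.snd W.snd).trans (h2.add h4)
  smul_mem' := by
    rintro c U ⟨φ, hφ, h1, h2⟩
    refine ⟨c • φ, ⟨hφ.smooth.const_smul c, hφ.compact.smul_left (f := fun _ => c),
      (tsupport_smul_subset_right (fun _ => c) φ).trans hφ.supp⟩, ?_, ?_⟩
    · exact (Lp.coeFn_smul c U.fst).trans (h1.const_smul c)
    · have h : gradient (c • φ) = c • gradient φ := by
        ext1 x
        simp only [gradient, Pi.smul_apply]
        rw [fderiv_const_smul (hφ.smooth.differentiable (by simp) x), map_smul]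
      rw [h]
      exact (Lp.coeFn_smul c U.snd).trans (h2.const_smul c)

/-- `H¹₀(Ω)`: the closure of the test functions for the `H¹` norm. Each element is stored
together with its weak gradient (which it determines), as the limit in `L²(Ω) × L²(Ω)^d` of pairs `(φ, ∇φ)`; the
inherited norm is the `H¹` norm `(‖u‖² + ‖∇u‖²)^(1/2)`. -/
abbrev H10 {d : ℕ} (Ω : Set (Space d)) := (testPairs Ω).topologicalClosure

/-- The function underlying an element of `H¹₀(Ω)`. -/
def toL2 {d : ℕ} {Ω : Set (Space d)} (U : H10 Ω) : L2 Ω := U.1.fst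

/-- The weak gradient of an element of `H¹₀(Ω)`. -/
def grad {d : ℕ} {Ω : Set (Space d)} (U : H10 Ω) : L2Vec Ω := U.1.snd

/-- `u` represents the class of the composite function `g ∘ w` on `Ω`. -/
def IsComp {d : ℕ} (Ω : Set (Space d)) (g : ℝ → ℝ) (w u : L2 Ω) : Prop :=
  ∀ᵐ x ∂(volume.restrict Ω), u x = g (w x)

/-- `μ = ζ ∘ (β + ζ)⁻¹` (`β + ζ` is bijective under the assumptions used, see
`bijective_add`). -/
def mu (β ζ : ℝ → ℝ) (t : ℝ) : ℝ := ζ (Function.invFun (fun s => β s + ζ s) t)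

/-- `ρ(t) = t - μ(t)`. -/
def rho (β ζ : ℝ → ℝ) (t : ℝ) : ℝ := t - mu β ζ t

/-- `ν(s) = ∫₀ˢ √(μ'(r)) dr` (`μ` is Lipschitz continuous and non-decreasing, so that `μ'` exists
almost everywhere). -/
def nu (β ζ : ℝ → ℝ) (s : ℝ) : ℝ := ∫ r in (0 : ℝ)..s, Real.sqrt (deriv (mu β ζ) r)

/-- `β + ζ` is a bijection of `ℝ`, so that its inverse in `mu` is the genuine one. -/
theorem bijective_add (β ζ : ℝ → ℝ) (hβ : Continuous β) (hβm : Monotone β) (hβ0 : β 0 = 0)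
    (hζ : Continuous ζ) (hζm : Monotone ζ) (hζ0 : ζ 0 = 0)
    (hζg : ∃ M₀ > 0, ∃ M₁ > 0, ∀ s : ℝ, M₀ * |s| - M₁ ≤ |ζ s|)
    (hinc : StrictMono fun s => β s + ζ s) :
    Function.Bijective fun s => β s + ζ s := by
  obtain ⟨M₀, hM₀, M₁, -, h⟩ := hζg
  refine ⟨hinc.injective, (hβ.add hζ).surjective ?_ ?_⟩
  · have ht : Tendsto (fun s : ℝ => M₀ * s - M₁) atTop atTop :=
      tendsto_atTop_add_const_right _ _ (tendsto_id.const_mul_atTop hM₀)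
    refine tendsto_atTop_mono' _ ?_ ht
    filter_upwards [eventually_ge_atTop 0] with s hs
    have h1 := h s
    have h2 := hβm hs
    have h3 := hζm hs
    rw [hβ0] at h2
    rw [hζ0] at h3
    rw [abs_of_nonneg hs, abs_of_nonneg h3] at h1
    change M₀ * s - M₁ ≤ β s + ζ s
    linarith
  · have ht : Tendsto (fun s : ℝ => M₀ * s + M₁) atBot atBot :=
      tendsto_atBot_add_const_right _ _ (tendsto_id.const_mul_atBot hM₀)
    refine tendsto_atBot_mono' _ ?_ ht
    filter_upwards [eventually_le_atBot 0] with s hs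
    have h1 := h s
    have h2 := hβm hs
    have h3 := hζm hs
    rw [hβ0] at h2
    rw [hζ0] at h3
    rw [abs_of_nonpos hs, abs_of_nonpos h3] at h1
    change β s + ζ s ≤ M₀ * s + M₁
    linarith

/-- The diffusion form `∫_Ω Λ ∇U · ∇V`. -/
def diffusion {d : ℕ} (Ω : Set (Space d)) (Λ : Space d → Matrix (Fin d) (Fin d) ℝ)
    (U V : H10 Ω) : ℝ :=
  ∫ x in Ω, inner ℝ (Matrix.toEuclideanLin (Λ x) (grad U x)) (grad V x)

/-- `w ∈ L²(Ω)` is such that `μ(w) ∈ H¹₀(Ω)` and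
`∫ ρ(w) v + ∫ Λ ∇μ(w) · ∇v = ∫ f v` for all test elements `v` in `T ⊆ H¹₀(Ω)`. -/
def SolvesAgainst {d : ℕ} (Ω : Set (Space d)) (Λ : Space d → Matrix (Fin d) (Fin d) ℝ)
    (f : L2 Ω) (β ζ : ℝ → ℝ) (T : Submodule ℝ (H10 Ω)) (w : L2 Ω) : Prop :=
  ∃ M : H10 Ω, IsComp Ω (mu β ζ) w (toL2 M) ∧
    ∀ v ∈ T, (∫ x in Ω, rho β ζ (w x) * toL2 v x) + diffusion Ω Λ M v
      = ∫ x in Ω, f x * toL2 v x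

/-- `w` is a solution of the continuous weak problem. -/
def IsWeakSolution {d : ℕ} (Ω : Set (Space d)) (Λ : Space d → Matrix (Fin d) (Fin d) ℝ)
    (f : L2 Ω) (β ζ : ℝ → ℝ) (w : L2 Ω) : Prop :=
  SolvesAgainst Ω Λ f β ζ ⊤ w

/-- `w ∈ V` is a solution of the conforming Galerkin scheme on `V`. -/
def IsSchemeSolution {d : ℕ} (Ω : Set (Space d)) (Λ : Space d → Matrix (Fin d) (Fin d) ℝ)
    (f : L2 Ω) (β ζ : ℝ → ℝ) (V : Submodule ℝ (H10 Ω)) (w : H10 Ω) : Prop :=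
  w ∈ V ∧ SolvesAgainst Ω Λ f β ζ V (toL2 w)

/-- Weak convergence of a sequence in a normed space. -/
def TendstoWeakly {X : Type*} [NormedAddCommGroup X] [NormedSpace ℝ X] (u : ℕ → X) (u' : X) :
    Prop :=
  Tendsto (fun m => toWeakSpace ℝ X (u m)) atTop (𝓝 (toWeakSpace ℝ X u'))

end DegenElliptic

end

open DegenElliptic

/-! Write `m` for `μ`. Beyond `m 0 = 0`, the proof uses only `Admissible m`: `m` and `t - m t` are
non-decreasing, so `m` is 1-Lipschitz, and `|t| ≤ A|m t| + B`.

A priori bounds come from testing the scheme with `w` itself, which is allowed because `w ∈ V`. The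
chain rule `primComp` turns `Λ∇μ(w)·∇w` into `Λ∇ν(w)·∇ν(w)`, and `ρ(w)w ≥ 0`. Since `|w| ≤ A|ν(w)| +
B`, the Poincaré inequality closes the estimate. It bounds `w` in `L²` and `μ(w)`, `ν(w)` in `H¹₀`,
but not `∇w`. The same coercivity gives a solution in each `V m` through a Brouwer-type zero theorem
(`exists_zero_of_inner_pos`), which is derived from the absence of smooth retractions of a ball on
its sphere.

In the limit, `w` converges weakly in `L²`, and `μ(w)` converges weakly in `H¹₀`, hence strongly in
`L²` by Rellich's theorem. The inequality `‖μ(w) - μ(w')‖² ≤ (μ(w) - μ(w'), w - w')` then pairs a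
strong limit with a weak one and identifies the limit of `μ(w)` as `μ` of the limit. The equation is
affine in the pair `(w, μ(w))`, so it passes to the limit. For uniqueness, the difference of two
equations is tested with the difference of the `μ`'s. Uniqueness upgrades subsequences to the whole
sequence. By Cauchy–Schwarz, `(ν(s) - ν(t))² ≤ (s - t)(μ(s) - μ(t))`, so `ν(w)` converges strongly
in `L²` as well.

The weak solution is only in `L²` and cannot be used as a test function, so its energy equality is
an assumption. When it holds, subtracting it from the discrete equality shows that a sum of two
non-negative terms tends to zero (`tendsto_of_energy`). This gives strong convergence of `∇ν(w)` and
of `w`. -/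

section Brouwer

/-! ### Absence of smooth retractions and zeros of outward-pointing maps -/

variable {E : Type*} [NormedAddCommGroup E] [InnerProductSpace ℝ E]

/-- A Lipschitz map on a closed ball that vanishes on the sphere extends by zero to a
Lipschitz map. -/
theorem lipschitzWith_indicator_closedBall {g : E → E} {ρ : ℝ} {L : NNReal}
    (hg : LipschitzOnWith L g (Metric.closedBall 0 ρ)) (h0 : ∀ x, ‖x‖ = ρ → g x = 0) :
    LipschitzWith L ((Metric.closedBall (0 : E) ρ).indicator g) := by
  classical
  -- The segment from `x` to `y` meets the sphere at a point where `g` vanishes and which is no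
  -- farther from `x` than `y` is.
  have key : ∀ x y : E, ‖x‖ ≤ ρ → ρ < ‖y‖ → ‖g x‖ ≤ L * ‖x - y‖ := by
    intro x y hx hy
    have hcont : Continuous fun s : ℝ => ‖x + s • (y - x)‖ := by fun_prop
    obtain ⟨s, hs, hsρ⟩ : ρ ∈ (fun s : ℝ => ‖x + s • (y - x)‖) '' Set.Icc 0 1 := by
      apply intermediate_value_Icc zero_le_one hcont.continuousOn
      constructor
      · simpa using hx
      · simpa using hy.le
    have hd := hg.dist_le_mul x (by simpa using hx) (x + s • (y - x)) (by
      simpa using hsρ.le)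
    rw [h0 _ hsρ, dist_zero_right, dist_eq_norm, sub_add_cancel_left, norm_neg, norm_smul,
      Real.norm_of_nonneg hs.1, norm_sub_rev y x] at hd
    refine hd.trans ?_
    gcongr
    exact mul_le_of_le_one_left (norm_nonneg _) hs.2
  refine LipschitzWith.of_dist_le_mul fun x y => ?_
  by_cases hx : ‖x‖ ≤ ρ <;> by_cases hy : ‖y‖ ≤ ρ
  · rw [Set.indicator_of_mem (by simpa using hx), Set.indicator_of_mem (by simpa using hy)]
    exact hg.dist_le_mul x (by simpa using hx) y (by simpa using hy)
  · rw [Set.indicator_of_mem (by simpa using hx), Set.indicator_of_notMem (by simpa using hy),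
      dist_zero_right, dist_eq_norm]
    exact key x y hx (not_le.1 hy)
  · rw [Set.indicator_of_notMem (by simpa using hx), Set.indicator_of_mem (by simpa using hy),
      dist_zero_left, dist_eq_norm, norm_sub_rev]
    exact key y x hy (not_le.1 hx)
  · rw [Set.indicator_of_notMem (by simpa using hx), Set.indicator_of_notMem (by simpa using hy)]
    simp only [dist_self]
    positivity

variable [FiniteDimensional ℝ E]

/-- `t ↦ det (1 + t A)` is a polynomial of degree at most the dimension. -/
theorem exists_polynomial_det_one_add_smul (A : E →L[ℝ] E) :
    ∃ p : Polynomial ℝ, p.natDegree ≤ Module.finrank ℝ E ∧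
      ∀ t : ℝ, (1 + t • A : E →L[ℝ] E).det = p.eval t := by
  classical
  let b := Module.finBasis ℝ E
  let M := LinearMap.toMatrix b b (A : E →ₗ[ℝ] E)
  refine ⟨Matrix.det ((Polynomial.X : Polynomial ℝ) • M.map Polynomial.C +
    (1 : Matrix _ _ ℝ).map Polynomial.C), ?_, fun t => ?_⟩
  · simpa using Polynomial.natDegree_det_X_add_C_le M 1
  · rw [← Polynomial.coe_evalRingHom, RingHom.map_det]
    have h1 : (1 + t • A : E →L[ℝ] E).det = LinearMap.det (1 + t • (A : E →ₗ[ℝ] E)) := rfl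
    rw [h1, ← LinearMap.det_toMatrix b]
    congr 1
    rw [map_add, map_smul, LinearMap.toMatrix_one]
    ext i j
    simp only [RingHom.mapMatrix_apply, Matrix.map_apply, Matrix.add_apply, Matrix.smul_apply,
      Polynomial.coe_evalRingHom, smul_eq_mul, Polynomial.eval_add, Polynomial.eval_mul,
      Polynomial.eval_X, Polynomial.eval_C, M]
    ring

/-- If the integrals of polynomials of bounded degree are constant for small parameters, they are
constant. -/
theorem integral_eval_one_eq_of_forall_small {α : Type*} [MeasurableSpace α] (μ : Measure α)
    (n : ℕ) (p : α → Polynomial ℝ) (hp : ∀ x, (p x).natDegree ≤ n) {t₀ c : ℝ} (ht₀ : 0 < t₀)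
    (hi : ∀ t ∈ Set.Icc 0 t₀, Integrable (fun x => (p x).eval t) μ)
    (hc : ∀ t ∈ Set.Icc 0 t₀, ∫ x, (p x).eval t ∂μ = c) :
    ∫ x, (p x).eval 1 ∂μ = c := by
  classical
  let s := Finset.range (n + 1)
  -- These are `n + 1` distinct nodes in `[0, t₀]`. Lagrange interpolation writes the value at 1 as
  -- a combination of the values at the nodes, with weights independent of `x` and of sum 1.
  let v : ℕ → ℝ := fun k => t₀ * (k / (n + 1))
  have hv : Set.InjOn v s := by
    intro a _ b _ hab
    have h : (n + 1 : ℝ) ≠ 0 := by positivity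
    have := mul_left_cancel₀ ht₀.ne' hab
    field_simp at this
    exact_mod_cast this
  have hvm : ∀ k ∈ s, v k ∈ Set.Icc 0 t₀ := by
    intro k hk
    have hk' : (k : ℝ) ≤ n + 1 := by exact_mod_cast (Finset.mem_range.1 hk).le
    refine ⟨by positivity, ?_⟩
    have : (k : ℝ) / (n + 1) ≤ 1 := by
      rw [div_le_one (by positivity)]; exact hk'
    calc t₀ * (k / (n + 1)) ≤ t₀ * 1 := by gcongr
      _ = t₀ := mul_one _
  have key : ∀ x, (p x).eval 1 = ∑ k ∈ s, (Lagrange.basis s v k).eval 1 * (p x).eval (v k) := by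
    intro x
    have hd : (p x).degree < s.card := by
      refine lt_of_le_of_lt Polynomial.degree_le_natDegree ?_
      rw [Finset.card_range]
      exact_mod_cast Nat.lt_succ_of_le (hp x)
    conv_lhs => rw [Lagrange.eq_interpolate hv hd]
    rw [Lagrange.interpolate_apply, Polynomial.eval_finsetSum]
    refine Finset.sum_congr rfl fun k _ => ?_
    simp [mul_comm]
  have hs : ∑ k ∈ s, (Lagrange.basis s v k).eval 1 = 1 := by
    rw [← Polynomial.eval_finsetSum, Lagrange.sum_basis hv ⟨0, by simp [s]⟩]
    simp
  simp_rw [key]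
  rw [integral_finsetSum _ fun k hk => (hi _ (hvm k hk)).const_mul _]
  rw [Finset.sum_congr rfl fun k hk => by rw [integral_const_mul, hc _ (hvm k hk)],
    ← Finset.sum_mul, hs, one_mul]

/-- A perturbation of the identity by a contraction is bijective. -/
theorem bijective_id_add_of_contracting {h : E → E} {K : NNReal} (hK : ContractingWith K h) :
    Function.Bijective fun x => x + h x := by
  have hK1 : (K : ℝ) < 1 := hK.1
  refine ⟨fun x y hxy => ?_, fun y => ?_⟩
  · have h1 := hK.2.dist_le_mul x y
    have h2 : x - y = h y - h x := by
      rw [sub_eq_sub_iff_add_eq_add]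
      exact hxy.trans (add_comm _ _)
    rw [dist_eq_norm, dist_eq_norm, norm_sub_rev (h x), ← h2] at h1
    have h3 : ‖x - y‖ ≤ 0 := by nlinarith [norm_nonneg (x - y)]
    exact sub_eq_zero.1 (norm_le_zero_iff.1 h3)
  · have hc : ContractingWith K fun x => y - h x := by
      refine ⟨hK.1, LipschitzWith.of_dist_le_mul fun a b => ?_⟩
      rw [dist_sub_left]
      exact hK.2.dist_le_mul a b
    refine ⟨hc.fixedPoint _, ?_⟩
    exact sub_eq_iff_eq_add.1 hc.fixedPoint_isFixedPt.eq |>.symm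

/-- For small `t`, the determinant of `1 + t A` is positive. -/
theorem det_one_add_smul_pos (A : E →L[ℝ] E) {t : ℝ} (ht : 0 ≤ t) (htA : t * ‖A‖ < 1) :
    0 < (1 + t • A : E →L[ℝ] E).det := by
  by_contra hneg
  rw [not_lt] at hneg
  obtain ⟨p, -, hp⟩ := exists_polynomial_det_one_add_smul A
  have h1 : p.eval 0 = 1 := by
    rw [← hp]
    simp [ContinuousLinearMap.det]
  -- The determinant is 1 at `0`, so a non-positive value at `t` forces a zero at some `s ≤ t`. A
  -- kernel vector of `1 + s A` then contradicts `‖s A‖ < 1`.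
  obtain ⟨s, hs, hs0⟩ : (0 : ℝ) ∈ (fun s => p.eval s) '' Set.Icc 0 t := by
    apply intermediate_value_Icc' ht p.continuous.continuousOn
    rw [hp] at hneg
    exact ⟨hneg, by rw [h1]; exact zero_le_one⟩
  replace hs0 := (hp s).trans hs0
  have hlt : ‖s • A‖ < 1 := by
    rw [norm_smul, Real.norm_of_nonneg hs.1]
    exact lt_of_le_of_lt (mul_le_mul_of_nonneg_right hs.2 (norm_nonneg _)) htA
  have hker := LinearMap.bot_lt_ker_of_det_eq_zero hs0
  obtain ⟨x, hx, hx0⟩ := (Submodule.ne_bot_iff _).1 hker.ne'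
  have hx' : x + (s • A) x = 0 := hx
  have h2 : ‖x‖ = ‖(s • A) x‖ := by
    conv_lhs => rw [eq_neg_of_add_eq_zero_left hx', norm_neg]
  have h3 := (s • A).le_opNorm x
  have h4 : 0 < ‖x‖ := norm_pos_iff.2 hx0
  nlinarith

variable [MeasurableSpace E] [BorelSpace E]

/-- There is no continuously differentiable retraction of a ball on its sphere. -/
theorem no_contDiff_retraction {r : E → E} {ρ : ℝ} (hρ : 0 < ρ) (hr : ContDiff ℝ 1 r)
    (hn : ∀ x, ‖r x‖ = ρ) (hid : ∀ x, ‖x‖ = ρ → r x = x) : False := by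
  -- For small `t` the map `id + t (r - id)`, extended by the identity, is a bijection preserving
  -- the ball. The integral of its Jacobian over the ball is therefore the volume of the ball. This
  -- integral is polynomial in `t`, so the equality persists at `t = 1`, where the Jacobian is `det
  -- Dr = 0`.
  let B := Metric.closedBall (0 : E) ρ
  let b := Metric.ball (0 : E) ρ
  obtain ⟨L, hL⟩ := (hr.sub contDiff_id).contDiffOn.exists_lipschitzOnWith (s := B) one_ne_zero
    (convex_closedBall _ _) (isCompact_closedBall _ _)
  let g := B.indicator (fun x => r x - x)
  have hgL : LipschitzWith L g := lipschitzWith_indicator_closedBall hL fun x hx => by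
    simp [hid x hx]
  have hA : ∀ x ∈ b, HasFDerivAt g (fderiv ℝ r x - 1) x := by
    intro x hx
    have h1 : HasFDerivAt (fun x => r x - x) (fderiv ℝ r x - 1) x :=
      (hr.differentiable one_ne_zero x).hasFDerivAt.sub (hasFDerivAt_id x)
    refine h1.congr_of_eventuallyEq ?_
    filter_upwards [Metric.isOpen_ball.mem_nhds hx] with y hy
    exact Set.indicator_of_mem (Metric.ball_subset_closedBall hy) _
  have hAn : ∀ x ∈ b, ‖fderiv ℝ r x - 1‖ ≤ L := fun x hx => by
    have := norm_fderiv_le_of_lipschitz ℝ hgL (x₀ := x)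
    rwa [(hA x hx).fderiv] at this
  choose p hpd hp using fun x => exists_polynomial_det_one_add_smul (fderiv ℝ r x - 1)
  let t₀ : ℝ := 1 / (L + 1)
  have ht₀ : 0 < t₀ := by positivity
  have ht₀L : t₀ * L < 1 := by
    simp only [t₀]; rw [one_div, inv_mul_lt_iff₀ (by positivity)]; linarith
  have hcont : ∀ t, Continuous fun x => (p x).eval t := by
    intro t
    simp_rw [← hp]
    have : Continuous fun x => (1 + t • (fderiv ℝ r x - 1) : E →L[ℝ] E) := by
      have := hr.continuous_fderiv one_ne_zero
      fun_prop
    exact ContinuousLinearMap.continuous_det.comp this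
  have hint : ∀ t, IntegrableOn (fun x => (p x).eval t) b := fun t =>
    ((hcont t).continuousOn.integrableOn_compact (isCompact_closedBall (0 : E) ρ)).mono_set
      Metric.ball_subset_closedBall
  have hvol : ∀ t ∈ Set.Icc 0 t₀, ∫ x in b, (p x).eval t = volume.real b := by
    intro t ht
    have htL : t * L < 1 := lt_of_le_of_lt (mul_le_mul_of_nonneg_right ht.2 L.2) ht₀L
    have hcontr : ContractingWith (t.toNNReal * L) fun x => t • g x := by
      refine ⟨by rw [← NNReal.coe_lt_coe]; simpa [ht.1] using htL, LipschitzWith.of_dist_le_mul fun x y => ?_⟩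
      rw [dist_smul₀, Real.norm_of_nonneg ht.1, NNReal.coe_mul, Real.coe_toNNReal _ ht.1, mul_assoc]
      exact mul_le_mul_of_nonneg_left (hgL.dist_le_mul x y) ht.1
    have hbij := bijective_id_add_of_contracting hcontr
    set φ : E → E := fun x => x + t • g x with hφ
    have hout : ∀ x, x ∉ b → φ x = x := by
      intro x hx
      have : g x = 0 := by
        by_cases hxB : x ∈ B
        · have hxρ : ‖x‖ = ρ := le_antisymm (by simpa [B] using hxB) (by simpa [b] using hx)
          simp [g, hid x hxρ]
        · exact Set.indicator_of_notMem hxB _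
      simp [hφ, this]
    -- A bijection that fixes every point of the complement maps the ball onto itself.
    have himg : φ '' b = b := by
      have h1 : φ '' bᶜ = bᶜ := by
        exact (Set.image_congr (g := id) fun x hx => hout x hx).trans (Set.image_id _)
      rw [← compl_inj_iff, ← Set.image_compl_eq hbij, h1]
    have hder : ∀ x ∈ b, HasFDerivWithinAt φ (1 + t • (fderiv ℝ r x - 1)) b x := fun x hx =>
      ((hasFDerivAt_id x).add ((hA x hx).const_smul t)).hasFDerivWithinAt
    have hcv := integral_image_eq_integral_abs_det_fderiv_smul volume
      (Metric.isOpen_ball (x := (0 : E)) (ε := ρ)).measurableSet hder hbij.1.injOn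
      (fun _ => (1 : ℝ))
    rw [show φ '' Metric.ball 0 ρ = b from himg] at hcv
    simp only [smul_eq_mul, mul_one, integral_const, MeasurableSet.univ, measureReal_restrict_apply,
      Set.univ_inter] at hcv
    rw [hcv]
    refine setIntegral_congr_fun Metric.isOpen_ball.measurableSet fun x hx => ?_
    rw [← hp, abs_of_pos (det_one_add_smul_pos _ ht.1 (lt_of_le_of_lt
      (mul_le_mul_of_nonneg_left (hAn x hx) ht.1) htL))]
  have h1 := integral_eval_one_eq_of_forall_small (volume.restrict b) _ p hpd ht₀
    (fun t _ => hint t) hvol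
  -- Differentiating `‖r‖² = ρ²` shows that `r x` is orthogonal to the range of `Dr(x)`. If `Dr(x)`
  -- were invertible, `r x` would lie in that range and vanish.
  have hz : ∀ x, (p x).eval 1 = 0 := by
    intro x
    rw [← hp, one_smul, add_sub_cancel]
    by_contra hdet
    have hunit : IsUnit (LinearMap.det (fderiv ℝ r x : E →ₗ[ℝ] E)) := isUnit_iff_ne_zero.2 hdet
    have hsurj := (LinearMap.equivOfIsUnitDet hunit).surjective
    obtain ⟨y, hy⟩ := hsurj (r x)
    have hy' : fderiv ℝ r x y = r x := by simpa using hy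
    have hd : HasFDerivAt (fun x => inner ℝ (r x) (r x)) _ x :=
      (hr.differentiable one_ne_zero x).hasFDerivAt.inner ℝ
        (hr.differentiable one_ne_zero x).hasFDerivAt
    have hc : (fun x => inner ℝ (r x) (r x)) = fun _ => ρ ^ 2 := by
      ext z
      rw [real_inner_self_eq_norm_sq, hn]
    rw [hc] at hd
    have h0 := congrArg (fun T => T y) (hd.unique (hasFDerivAt_const _ _))
    simp [fderivInnerCLM_apply, hy', hn] at h0
    exact hρ.ne' h0
  simp only [hz, integral_zero] at h1
  exact (Metric.measure_ball_pos volume (0 : E) hρ).ne'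
    (((measureReal_eq_zero_iff (by simpa using measure_ball_lt_top.ne)).1 h1.symm))

/-- A continuous map of a finite-dimensional space that points outwards far away has a zero. -/
theorem exists_zero_of_inner_pos {F : E → E} (hF : Continuous F) {R : ℝ} (hR : 0 < R)
    (hpos : ∀ x, R ≤ ‖x‖ → 0 < inner ℝ (F x) x) : ∃ x, F x = 0 := by
  by_contra! hne
  -- The cutoff blends `F` inside radius `R` with the identity outside radius `R + 1`. In between,
  -- both fields pair positively with `x`, so the blend has no zero.
  let χ : E → ℝ := fun x => max 0 (min 1 (‖x‖ - R))
  let K : E → E := fun x => (1 - χ x) • F x + χ x • x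
  have hχ0 : ∀ x, 0 ≤ χ x := fun x => le_max_left _ _
  have hχ1 : ∀ x, χ x ≤ 1 := fun x => max_le zero_le_one (min_le_left _ _)
  have hKc : Continuous K := by fun_prop
  have hK0 : ∀ x, K x ≠ 0 := by
    intro x hx
    rcases le_total ‖x‖ R with h | h
    · have : χ x = 0 := max_eq_left ((min_le_right _ _).trans (by linarith))
      simp [K, this, hne x] at hx
    · have h2 : inner ℝ (K x) x = (1 - χ x) * inner ℝ (F x) x + χ x * ‖x‖ ^ 2 := by
        simp only [K, inner_add_left, real_inner_smul_left, real_inner_self_eq_norm_sq]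
      rw [hx, inner_zero_left] at h2
      have h3 := hpos x h
      have h4 : 0 < ‖x‖ ^ 2 := by have := hR.trans_le h; positivity
      have h5 := hχ0 x
      have h6 := hχ1 x
      rcases h5.eq_or_lt with h7 | h7
      · rw [← h7] at h2; linarith
      · nlinarith [mul_pos h7 h4, mul_nonneg (sub_nonneg.2 h6) h3.le]
  have hKid : ∀ x, R + 1 ≤ ‖x‖ → K x = x := by
    intro x hx
    have : χ x = 1 := by
      simp only [χ]
      rw [min_eq_left (by linarith), max_eq_right zero_le_one]
    simp [K, this]
  -- The tolerance `‖K x‖` keeps the smooth approximation away from zero, and `G = K = id` for `‖x‖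
  -- ≥ R + 2`. Radial projection of `G` on the sphere of radius `R + 2` is then a forbidden
  -- retraction.
  obtain ⟨G, hG, hGd, hGS, -⟩ := hKc.exists_contDiff_approx_and_eqOn 1 hKc.norm
    (fun x => norm_pos_iff.2 (hK0 x)) (S := {x | R + 2 ≤ ‖x‖}) (U := {x | R + 1 < ‖x‖})
    (isClosed_le continuous_const continuous_norm)
    ((isOpen_lt continuous_const continuous_norm).mem_nhdsSet.2 fun x hx => by
      simp only [Set.mem_ofPred_eq] at hx ⊢; linarith)
    (contDiffOn_id.congr fun x hx => hKid x (le_of_lt hx))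
  have hG0 : ∀ x, G x ≠ 0 := by
    intro x hx
    have := hGd x
    rw [hx, dist_zero_left] at this
    exact lt_irrefl _ this
  have hG1 : ContDiff ℝ 1 G := hG
  refine no_contDiff_retraction (r := fun x => ((R + 2) / ‖G x‖) • G x) (ρ := R + 2)
    (by linarith) ?_ ?_ ?_
  · exact (contDiff_const.div (hG1.norm ℝ hG0) fun x => norm_ne_zero_iff.2 (hG0 x)).smul hG1
  · intro x
    have := norm_pos_iff.2 (hG0 x)
    rw [norm_smul, norm_div, norm_norm, Real.norm_of_nonneg (by linarith)]
    field_simp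
  · intro x hx
    have h1 : G x = x := (hGS (by simp [hx])).trans (hKid x (by linarith))
    simp only [h1, hx]
    rw [div_self (by linarith), one_smul]

end Brouwer

/-! ### Test functions, weak gradients and the Poincaré inequality -/

noncomputable section

namespace DegenElliptic

variable {d : ℕ} {Ω : Set (Space d)}

/-- The embedding of `H¹₀(Ω)` in `L²(Ω)`. -/
def toL2L (Ω : Set (Space d)) : H10 Ω →L[ℝ] L2 Ω :=
  (WithLp.fstL 2 ℝ (L2 Ω) (L2Vec Ω)).comp (testPairs Ω).topologicalClosure.subtypeL

/-- The weak gradient as a continuous linear map. -/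
def gradL (Ω : Set (Space d)) : H10 Ω →L[ℝ] L2Vec Ω :=
  (WithLp.sndL 2 ℝ (L2 Ω) (L2Vec Ω)).comp (testPairs Ω).topologicalClosure.subtypeL

theorem toL2L_apply (U : H10 Ω) : toL2L Ω U = toL2 U := rfl

theorem toL2_add (U W : H10 Ω) : toL2 (U + W) = toL2 U + toL2 W := rfl

theorem toL2_sub (U W : H10 Ω) : toL2 (U - W) = toL2 U - toL2 W := rfl

theorem toL2_smul (c : ℝ) (U : H10 Ω) : toL2 (c • U) = c • toL2 U := rfl

theorem grad_add (U W : H10 Ω) : grad (U + W) = grad U + grad W := rfl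

theorem grad_sub (U W : H10 Ω) : grad (U - W) = grad U - grad W := rfl

theorem grad_smul (c : ℝ) (U : H10 Ω) : grad (c • U) = c • grad U := rfl

theorem norm_sq_eq (U : H10 Ω) : ‖U‖ ^ 2 = ‖toL2 U‖ ^ 2 + ‖grad U‖ ^ 2 :=
  WithLp.prod_norm_sq_eq_of_L2 U.1

theorem norm_toL2_le (U : H10 Ω) : ‖toL2 U‖ ≤ ‖U‖ := by
  have := norm_sq_eq U
  exact le_of_sq_le_sq (by nlinarith [sq_nonneg ‖grad U‖]) (norm_nonneg _)

theorem norm_grad_le (U : H10 Ω) : ‖grad U‖ ≤ ‖U‖ := by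
  have := norm_sq_eq U
  exact le_of_sq_le_sq (by nlinarith [sq_nonneg ‖toL2 U‖]) (norm_nonneg _)

theorem ext_of_toL2_grad {U W : H10 Ω} (h1 : toL2 U = toL2 W) (h2 : grad U = grad W) : U = W :=
  Subtype.ext (WithLp.ofLp_injective 2 (Prod.ext h1 h2))

namespace IsTest

variable {φ : Space d → ℝ}

theorem continuous_gradient (hφ : IsTest Ω φ) : Continuous (gradient φ) :=
  (InnerProductSpace.toDual ℝ (Space d)).symm.continuous.comp
    (hφ.smooth.continuous_fderiv (by simp))

theorem hasCompactSupport_gradient (hφ : IsTest Ω φ) : HasCompactSupport (gradient φ) :=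
  (hφ.compact.fderiv (𝕜 := ℝ)).comp_left (g := (InnerProductSpace.toDual ℝ (Space d)).symm)
    (map_zero _)

theorem memLp (hφ : IsTest Ω φ) : MemLp φ 2 (volume.restrict Ω) :=
  (hφ.smooth.continuous.memLp_of_hasCompactSupport hφ.compact).restrict _

theorem memLp_gradient (hφ : IsTest Ω φ) : MemLp (gradient φ) 2 (volume.restrict Ω) :=
  (hφ.continuous_gradient.memLp_of_hasCompactSupport hφ.hasCompactSupport_gradient).restrict _

theorem eq_zero_of_notMem (hφ : IsTest Ω φ) {x : Space d} (hx : x ∉ Ω) : φ x = 0 :=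
  image_eq_zero_of_notMem_tsupport fun h => hx (hφ.supp h)

theorem gradient_eq_zero_of_notMem (hφ : IsTest Ω φ) {x : Space d} (hx : x ∉ Ω) :
    gradient φ x = 0 := by
  have : fderiv ℝ φ x = 0 :=
    image_eq_zero_of_notMem_tsupport fun h => hx (hφ.supp (tsupport_fderiv_subset ℝ h))
  simp [gradient, this]

/-- A test function as an element of `H¹₀(Ω)`. -/
def toH10 (hφ : IsTest Ω φ) : H10 Ω :=
  ⟨WithLp.toLp 2 (hφ.memLp.toLp φ, hφ.memLp_gradient.toLp _),
    (testPairs Ω).le_topologicalClosure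
      ⟨φ, hφ, hφ.memLp.coeFn_toLp, hφ.memLp_gradient.coeFn_toLp⟩⟩

theorem toL2_toH10 (hφ : IsTest Ω φ) : toL2 hφ.toH10 =ᵐ[volume.restrict Ω] φ :=
  hφ.memLp.coeFn_toLp

theorem grad_toH10 (hφ : IsTest Ω φ) : grad hφ.toH10 =ᵐ[volume.restrict Ω] gradient φ :=
  hφ.memLp_gradient.coeFn_toLp

end IsTest

theorem exists_toH10_dist_lt (U : H10 Ω) {ε : ℝ} (hε : 0 < ε) :
    ∃ (φ : Space d → ℝ) (hφ : IsTest Ω φ), ‖U - hφ.toH10‖ < ε := by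
  obtain ⟨W, ⟨φ, hφ, h1, h2⟩, hW⟩ := Metric.mem_closure_iff.1 U.2 ε hε
  refine ⟨φ, hφ, ?_⟩
  have : (hφ.toH10 : WithLp 2 (L2 Ω × L2Vec Ω)) = W := by
    apply WithLp.ofLp_injective
    exact Prod.ext (Lp.ext (hφ.toL2_toH10.trans h1.symm)) (Lp.ext (hφ.grad_toH10.trans h2.symm))
  rw [dist_eq_norm, ← this] at hW
  exact hW

/-- A closed property of test functions extends to `H¹₀(Ω)`. -/
theorem H10_induction {P : H10 Ω → Prop} (hc : IsClosed {U | P U})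
    (h : ∀ φ (hφ : IsTest Ω φ), P hφ.toH10) (U : H10 Ω) : P U := by
  have : U ∈ closure {U | P U} := Metric.mem_closure_iff.2 fun ε hε => by
    obtain ⟨φ, hφ, hU⟩ := exists_toH10_dist_lt U hε
    exact ⟨_, h φ hφ, by rwa [dist_eq_norm]⟩
  rwa [hc.closure_eq] at this

theorem inner_gradient (φ : Space d → ℝ) (x v : Space d) :
    inner ℝ (gradient φ x) v = fderiv ℝ φ x v := by
  rw [gradient, InnerProductSpace.toDual_symm_apply]

theorem inner_L2_eq (u v : L2 Ω) : inner ℝ u v = ∫ x in Ω, u x * v x := by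
  rw [L2.inner_def]
  exact integral_congr_ae (Eventually.of_forall fun x => mul_comm _ _)

/-- Since `φ` and its gradient vanish off `Ω`, this is integration by parts on the whole space. No
regularity of the boundary enters, and only one factor needs compact support. -/
theorem integral_smul_fderiv_of_isTest {φ ψ : Space d → ℝ} (hφ : IsTest Ω φ)
    (hψ : ContDiff ℝ ∞ ψ) (v : Space d) :
    ∫ x in Ω, φ x * fderiv ℝ ψ x v = -∫ x in Ω, inner ℝ (gradient φ x) v * ψ x := by
  have hc1 := hφ.smooth.continuous
  have hc2 := hψ.continuous
  have hc3 := hφ.smooth.continuous_fderiv_apply (n := ∞) (by simp)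
  have hc4 := hψ.continuous_fderiv_apply (n := ∞) (by simp)
  have hc3' : Continuous fun x => fderiv ℝ φ x v := hc3.comp (continuous_id.prodMk continuous_const)
  have hc4' : Continuous fun x => fderiv ℝ ψ x v := hc4.comp (continuous_id.prodMk continuous_const)
  rw [setIntegral_eq_integral_of_forall_compl_eq_zero fun x hx => by
      rw [hφ.eq_zero_of_notMem hx, zero_mul],
    setIntegral_eq_integral_of_forall_compl_eq_zero fun x hx => by
      rw [hφ.gradient_eq_zero_of_notMem hx, inner_zero_left, zero_mul]]
  simp_rw [inner_gradient]
  refine integral_mul_fderiv_eq_neg_fderiv_mul_of_integrable ?_ ?_ ?_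
    (fun x _ => hφ.smooth.differentiable (by simp) x)
    (fun x _ => hψ.differentiable (by simp) x)
  · exact (hc3'.mul hc2).integrable_of_hasCompactSupport
      ((hφ.compact.fderiv_apply (𝕜 := ℝ) v).mul_right)
  · exact (hc1.mul hc4').integrable_of_hasCompactSupport hφ.compact.mul_right
  · exact (hc1.mul hc2).integrable_of_hasCompactSupport hφ.compact.mul_right

/-- An element of `L²(Ω)` orthogonal to all test functions vanishes. -/
theorem eq_zero_of_forall_test [IsFiniteMeasure (volume.restrict Ω)] (hΩ : IsOpen Ω)
    {w : Space d → ℝ} (hw : MemLp w 2 (volume.restrict Ω))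
    (h : ∀ φ, IsTest Ω φ → ∫ x in Ω, φ x * w x = 0) : w =ᵐ[volume.restrict Ω] 0 := by
  rw [EventuallyEq, ae_restrict_iff' hΩ.measurableSet]
  refine hΩ.ae_eq_zero_of_integral_contDiff_smul_eq_zero
    (IntegrableOn.locallyIntegrableOn (hw.integrable one_le_two)) fun φ h1 h2 h3 => ?_
  have hφ : IsTest Ω φ := ⟨h1, h2, h3⟩
  rw [← h φ hφ, setIntegral_eq_integral_of_forall_compl_eq_zero fun x hx => by
      rw [hφ.eq_zero_of_notMem hx, zero_mul]]
  rfl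

/-- `H¹₀(Ω)` is dense in `L²(Ω)`. -/
theorem eq_zero_of_forall_inner_toL2 [IsFiniteMeasure (volume.restrict Ω)] (hΩ : IsOpen Ω)
    {w : L2 Ω} (h : ∀ U : H10 Ω, inner ℝ w (toL2 U) = 0) : w = 0 := by
  refine Lp.ext ((eq_zero_of_forall_test hΩ (Lp.memLp w) fun φ hφ => ?_).trans
    (Lp.coeFn_zero _ _ _).symm)
  rw [← h hφ.toH10, inner_L2_eq]
  refine integral_congr_ae ?_
  filter_upwards [hφ.toL2_toH10] with x hx
  rw [hx, mul_comm]

/-- For fixed `ψ` both sides are `L²` pairings, hence continuous in `U`, and the identity extends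
from test functions to their closure. It says that `grad U` is the distributional gradient of `toL2
U`. -/
theorem integral_toL2_mul_fderiv {ψ : Space d → ℝ} (hψ : IsTest Ω ψ) (v : Space d) (U : H10 Ω) :
    ∫ x in Ω, toL2 U x * fderiv ℝ ψ x v = -∫ x in Ω, inner ℝ (grad U x) v * ψ x := by
  have hc4 := hψ.smooth.continuous_fderiv_apply (n := ∞) (by simp)
  have hc4' : Continuous fun x => fderiv ℝ ψ x v := hc4.comp (continuous_id.prodMk continuous_const)
  have m1 : MemLp (fun x => fderiv ℝ ψ x v) 2 (volume.restrict Ω) :=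
    (hc4'.memLp_of_hasCompactSupport (hψ.compact.fderiv_apply (𝕜 := ℝ) v)).restrict _
  have m2 : MemLp (fun x => ψ x • v) 2 (volume.restrict Ω) :=
    (Continuous.memLp_of_hasCompactSupport (by have := hψ.smooth.continuous; fun_prop)
      hψ.compact.smul_right).restrict _
  have e1 : ∀ U : H10 Ω, ∫ x in Ω, toL2 U x * fderiv ℝ ψ x v = inner ℝ (toL2 U) (m1.toLp _) := by
    intro U
    rw [inner_L2_eq]
    refine integral_congr_ae ?_
    filter_upwards [m1.coeFn_toLp] with x hx
    rw [hx]
  have e2 : ∀ U : H10 Ω, ∫ x in Ω, inner ℝ (grad U x) v * ψ x =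
      inner ℝ (grad U) (m2.toLp _) := by
    intro U
    rw [L2.inner_def]
    refine integral_congr_ae ?_
    filter_upwards [m2.coeFn_toLp] with x hx
    rw [hx, real_inner_smul_right, mul_comm]
  refine H10_induction (P := fun U => ∫ x in Ω, toL2 U x * fderiv ℝ ψ x v =
    -∫ x in Ω, inner ℝ (grad U x) v * ψ x) ?_ (fun φ hφ => ?_) U
  · simp_rw [e1, e2]
    exact isClosed_eq ((toL2L Ω).continuous.inner continuous_const)
      ((gradL Ω).continuous.inner continuous_const).neg
  · have h := integral_smul_fderiv_of_isTest hφ hψ.smooth v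
    rw [integral_congr_ae (g := fun x => φ x * fderiv ℝ ψ x v)
        (by filter_upwards [hφ.toL2_toH10] with x hx; rw [hx]),
      integral_congr_ae (f := fun x => inner ℝ (grad hφ.toH10 x) v * ψ x)
        (by filter_upwards [hφ.grad_toH10] with x hx; rw [hx])]
    exact h

/-- An element of `H¹₀(Ω)` is determined by its underlying function. -/
theorem toL2_injective [IsFiniteMeasure (volume.restrict Ω)] (hΩ : IsOpen Ω) :
    Function.Injective (toL2 : H10 Ω → L2 Ω) := by
  intro U W hUW
  rw [← sub_eq_zero]
  set Z := U - W with hZ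
  have h0 : toL2 Z = 0 := sub_eq_zero.2 hUW
  refine ext_of_toL2_grad h0 (Lp.ext ?_)
  -- Integration by parts against the zero function makes each component of the gradient orthogonal
  -- to all test functions.
  have hi : ∀ i : Fin d, ∀ᵐ x ∂(volume.restrict Ω), grad Z x i = 0 := by
    intro i
    have hm : MemLp (fun x => grad Z x i) 2 (volume.restrict Ω) :=
      (EuclideanSpace.proj (𝕜 := ℝ) i).comp_memLp' (Lp.memLp (grad Z))
    refine eq_zero_of_forall_test hΩ hm fun φ hφ => ?_
    have h1 := integral_toL2_mul_fderiv hφ (EuclideanSpace.single i 1) Z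
    have h2 : ∫ x in Ω, toL2 Z x * fderiv ℝ φ x (EuclideanSpace.single i 1) = 0 := by
      rw [← integral_zero (Space d) ℝ (μ := volume.restrict Ω)]
      refine integral_congr_ae ?_
      rw [h0]
      filter_upwards [Lp.coeFn_zero ℝ 2 (volume.restrict Ω)] with x hx
      rw [hx]; simp
    rw [h2, eq_comm, neg_eq_zero] at h1
    rw [← h1]
    refine integral_congr_ae (Eventually.of_forall fun x => ?_)
    simp [EuclideanSpace.inner_single_right, mul_comm]
  filter_upwards [ae_all_iff.2 hi, Lp.coeFn_zero (Space d) 2 (volume.restrict Ω)] with x hx hx0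
  have : grad (0 : H10 Ω) x = 0 := hx0
  rw [this]
  ext i
  simpa using hx i

/-- The Poincaré inequality. -/
theorem exists_poincare (hd : 0 < d) (hΩo : IsOpen Ω) (hΩ : Bornology.IsBounded Ω) :
    ∃ C : ℝ, 0 < C ∧ ∀ U : H10 Ω, ‖toL2 U‖ ≤ C * ‖grad U‖ := by
  obtain ⟨R, hR0, hR⟩ := hΩ.exists_pos_norm_le
  refine ⟨2 * R, by positivity, fun U => ?_⟩
  refine H10_induction (P := fun U => ‖toL2 U‖ ≤ 2 * R * ‖grad U‖)
    (isClosed_le (toL2L Ω).continuous.norm (continuous_const.mul (gradL Ω).continuous.norm))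
    (fun φ hφ => ?_) U
  let i : Fin d := ⟨0, hd⟩
  -- Integrating `φ ∂ᵢ(xᵢ φ)` by parts gives `‖φ‖² = -2 ∫ φ xᵢ ∂ᵢφ`. Since `|xᵢ| ≤ R` on `Ω`, the
  -- constant is `2R`.
  have hψ : ContDiff ℝ ∞ fun x : Space d => x i * φ x := by
    have := hφ.smooth
    fun_prop
  have h := integral_smul_fderiv_of_isTest hφ hψ (EuclideanSpace.single i 1)
  have hgi : ∀ x, inner ℝ (gradient φ x) (EuclideanSpace.single i (1 : ℝ)) = gradient φ x i :=
    fun x => (EuclideanSpace.inner_single_right i 1 _).trans (one_mul _)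
  have hder : ∀ x, fderiv ℝ (fun x : Space d => x i * φ x) x (EuclideanSpace.single i 1) =
      x i * gradient φ x i + φ x := by
    intro x
    have h1 : HasFDerivAt (fun x : Space d => x i) (EuclideanSpace.proj (𝕜 := ℝ) i) x :=
      (EuclideanSpace.proj (𝕜 := ℝ) i).hasFDerivAt
    have h2 := (hφ.smooth.differentiable (by simp) x).hasFDerivAt
    have h12 : HasFDerivAt (fun x : Space d => x i * φ x) _ x := h1.mul h2
    rw [h12.fderiv, ← hgi, inner_gradient]
    simp
  simp_rw [hder, hgi] at h
  let u := toL2 hφ.toH10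
  let G := grad hφ.toH10
  have mG : MemLp (fun x => x i * gradient φ x i) 2 (volume.restrict Ω) := by
    refine (Continuous.memLp_of_hasCompactSupport ?_ ?_).restrict _
    · have := hφ.continuous_gradient; fun_prop
    · exact HasCompactSupport.mul_left
        (hφ.hasCompactSupport_gradient.comp_left (g := fun v : Space d => v i) rfl)
  have i1 : Integrable (fun x => φ x * φ x) (volume.restrict Ω) := hφ.memLp.integrable_mul hφ.memLp
  have i2 : Integrable (fun x => φ x * (x i * gradient φ x i)) (volume.restrict Ω) :=
    hφ.memLp.integrable_mul mG
  have h3 : ‖u‖ ^ 2 = -2 * inner ℝ u (mG.toLp _) := by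
    rw [← real_inner_self_eq_norm_sq, inner_L2_eq, inner_L2_eq]
    have e1 : ∫ x in Ω, u x * u x = ∫ x in Ω, φ x * φ x :=
      integral_congr_ae (by filter_upwards [hφ.toL2_toH10] with x hx; simp only [u]; rw [hx])
    have e2 : ∫ x in Ω, u x * (mG.toLp _ : L2 Ω) x = ∫ x in Ω, φ x * (x i * gradient φ x i) :=
      integral_congr_ae (by
        filter_upwards [hφ.toL2_toH10, mG.coeFn_toLp] with x hx hx2; simp only [u]; rw [hx, hx2])
    rw [e1, e2]
    simp_rw [mul_add] at h
    rw [integral_add i2 i1] at h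
    have e3 : ∫ x in Ω, gradient φ x i * (x i * φ x) = ∫ x in Ω, φ x * (x i * gradient φ x i) :=
      integral_congr_ae (Eventually.of_forall fun x => by ring)
    rw [e3] at h
    linarith
  have h4 : ‖(mG.toLp _ : L2 Ω)‖ ≤ R * ‖G‖ := by
    refine Lp.norm_le_mul_norm_of_ae_le_mul ?_
    filter_upwards [hφ.grad_toH10, mG.coeFn_toLp, ae_restrict_mem hΩo.measurableSet]
      with x hx hx2 hxΩ
    simp only [G]
    rw [hx, hx2, norm_mul]
    exact mul_le_mul ((PiLp.norm_apply_le x i).trans (hR x hxΩ)) (PiLp.norm_apply_le _ i)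
      (norm_nonneg _) hR0.le
  have h5 := abs_real_inner_le_norm u (mG.toLp _ : L2 Ω)
  have h6 := neg_abs_le (inner ℝ u (mG.toLp _ : L2 Ω))
  have h7 : ‖u‖ * ‖u‖ ≤ ‖u‖ * (2 * R * ‖G‖) := by
    nlinarith [mul_le_mul_of_nonneg_left h4 (norm_nonneg u)]
  rcases (norm_nonneg u).eq_or_lt with h8 | h8
  · change ‖u‖ ≤ 2 * R * ‖G‖
    rw [← h8]; positivity
  · exact le_of_mul_le_mul_left h7 h8

end DegenElliptic

/-! ### Weak convergence in Hilbert spaces -/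

namespace DegenElliptic

section Weak

variable {X Y : Type*} [NormedAddCommGroup X] [NormedAddCommGroup Y]

theorem tendstoWeakly_iff [NormedSpace ℝ X] {u : ℕ → X} {u' : X} :
    TendstoWeakly u u' ↔ ∀ ℓ : X →L[ℝ] ℝ, Tendsto (fun n => ℓ (u n)) atTop (𝓝 (ℓ u')) := by
  have hinj : Function.Injective (topDualPairing ℝ X).flip := by
    intro x y hxy
    refine (SeparatingDual.eq_iff_forall_dual_eq (R := ℝ)).2 fun ℓ => ?_
    exact LinearMap.congr_fun hxy ℓ
  exact WeakBilin.tendsto_iff_forall_eval_tendsto (B := (topDualPairing ℝ X).flip) hinj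

theorem TendstoWeakly.clm [NormedSpace ℝ X] {u : ℕ → X} {u' : X} (h : TendstoWeakly u u')
    (ℓ : X →L[ℝ] ℝ) : Tendsto (fun n => ℓ (u n)) atTop (𝓝 (ℓ u')) :=
  tendstoWeakly_iff.1 h ℓ

theorem TendstoWeakly.map [NormedSpace ℝ X] [NormedSpace ℝ Y] {u : ℕ → X} {u' : X}
    (h : TendstoWeakly u u') (T : X →L[ℝ] Y) : TendstoWeakly (fun n => T (u n)) (T u') :=
  tendstoWeakly_iff.2 fun ℓ => h.clm (ℓ.comp T)

theorem TendstoWeakly.sub [NormedSpace ℝ X] {u v : ℕ → X} {u' v' : X}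
    (h : TendstoWeakly u u') (h2 : TendstoWeakly v v') :
    TendstoWeakly (fun n => u n - v n) (u' - v') :=
  tendstoWeakly_iff.2 fun ℓ => by simpa using (h.clm ℓ).sub (h2.clm ℓ)

theorem TendstoWeakly.comp [NormedSpace ℝ X] {u : ℕ → X} {u' : X} (h : TendstoWeakly u u')
    {k : ℕ → ℕ} (hk : Tendsto k atTop atTop) : TendstoWeakly (fun n => u (k n)) u' :=
  Tendsto.comp (g := fun n => toWeakSpace ℝ X (u n)) h hk

theorem tendstoWeakly_of_tendsto [NormedSpace ℝ X] {u : ℕ → X} {u' : X}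
    (h : Tendsto u atTop (𝓝 u')) : TendstoWeakly u u' :=
  tendstoWeakly_iff.2 fun ℓ => (ℓ.continuous.tendsto _).comp h

theorem TendstoWeakly.unique [NormedSpace ℝ X] {u : ℕ → X} {a b : X} (h : TendstoWeakly u a)
    (h2 : TendstoWeakly u b) : a = b :=
  (SeparatingDual.eq_iff_forall_dual_eq (R := ℝ)).2 fun ℓ => tendsto_nhds_unique (h.clm ℓ) (h2.clm ℓ)

theorem tendstoWeakly_of_subseq [NormedSpace ℝ X] {u : ℕ → X} {u' : X}
    (h : ∀ k : ℕ → ℕ, Tendsto k atTop atTop → ∃ j : ℕ → ℕ, TendstoWeakly (fun n => u (k (j n))) u') :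
    TendstoWeakly u u' :=
  tendsto_of_subseq_tendsto h

/-- The pairing of a weakly convergent bounded sequence with a strongly convergent one. -/
theorem TendstoWeakly.inner [InnerProductSpace ℝ X] {u v : ℕ → X} {u' v' : X}
    (h : TendstoWeakly u u') {C : ℝ} (hC : ∀ n, ‖u n‖ ≤ C) (hv : Tendsto v atTop (𝓝 v')) :
    Tendsto (fun n => Inner.inner ℝ (u n) (v n)) atTop (𝓝 (Inner.inner ℝ u' v')) := by
  have h1 := h.clm (innerSL ℝ v')
  -- The pairing splits as `(uₙ, v') + (uₙ, vₙ - v')`. The bound on `uₙ` kills the second term.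
  have h2 : Tendsto (fun n => Inner.inner ℝ (u n) (v n - v')) atTop (𝓝 0) := by
    refine squeeze_zero_norm (a := fun n => C * ‖v n - v'‖) (fun n => ?_) ?_
    · exact (norm_inner_le_norm _ _).trans (mul_le_mul_of_nonneg_right (hC n) (norm_nonneg _))
    · simpa using (tendsto_iff_norm_sub_tendsto_zero.1 hv).const_mul C
  have h3 := h1.add h2
  simp only [innerSL_apply_apply, add_zero] at h3
  refine (h3.congr fun n => ?_).trans (by rw [real_inner_comm])
  rw [inner_sub_right, real_inner_comm]
  ring

theorem tendstoWeakly_of_inner [InnerProductSpace ℝ X] [CompleteSpace X] {u : ℕ → X} {u' : X}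
    (h : ∀ y, Tendsto (fun n => Inner.inner ℝ (u n) y) atTop (𝓝 (Inner.inner ℝ u' y))) :
    TendstoWeakly u u' := by
  refine tendstoWeakly_iff.2 fun ℓ => ?_
  have h1 : ∀ x, ℓ x = Inner.inner ℝ x ((InnerProductSpace.toDual ℝ X).symm ℓ) := fun x => by
    rw [real_inner_comm, InnerProductSpace.toDual_symm_apply]
  simp_rw [h1]
  exact h _

/-- Bounded sequences in a separable Hilbert space have weakly convergent subsequences. -/
theorem exists_subseq_tendstoWeakly [InnerProductSpace ℝ X] [CompleteSpace X]
    [SecondCountableTopology X] {u : ℕ → X} {C : ℝ} (hC : ∀ n, ‖u n‖ ≤ C) :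
    ∃ u' : X, ∃ k : ℕ → ℕ, StrictMono k ∧ TendstoWeakly (fun n => u (k n)) u' := by
  -- The Riesz isometry moves the sequence to the dual, where closed balls are weak-* sequentially
  -- compact by separability.
  let D := InnerProductSpace.toDual ℝ X
  have hmem : ∀ n, StrongDual.toWeakDual (D (u n)) ∈
      WeakDual.toStrongDual ⁻¹' Metric.closedBall (0 : StrongDual ℝ X) C := by
    intro n
    simp [D, hC n]
  obtain ⟨L, -, k, hk, hL⟩ := WeakDual.isSeqCompact_closedBall ℝ X 0 C hmem
  refine ⟨D.symm (WeakDual.toStrongDual L), k, hk, tendstoWeakly_of_inner fun y => ?_⟩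
  have h1 := ((WeakDual.eval_continuous y).tendsto L).comp hL
  rw [InnerProductSpace.toDual_symm_apply]
  exact h1

end Weak

variable {d : ℕ} {Ω : Set (Space d)}

instance : SecondCountableTopology (H10 Ω) := by
  have : Fact ((2 : ENNReal) ≠ ⊤) := ⟨by simp⟩
  have h1 : SecondCountableTopology (L2 Ω) := inferInstance
  have h2 : SecondCountableTopology (L2Vec Ω) := inferInstance
  have : SecondCountableTopology (WithLp 2 (L2 Ω × L2Vec Ω)) :=
    (WithLp.homeomorphProd 2 (L2 Ω) (L2Vec Ω)).secondCountableTopology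
  infer_instance

instance : CompleteSpace (H10 Ω) :=
  (testPairs Ω).isClosed_topologicalClosure.completeSpace_coe

/-- A bounded sequence in `H¹₀(Ω)` that converges weakly in `L²(Ω)` converges weakly in
`H¹₀(Ω)`. -/
theorem tendstoWeakly_of_toL2 [IsFiniteMeasure (volume.restrict Ω)] (hΩ : IsOpen Ω)
    {U : ℕ → H10 Ω} {U' : H10 Ω} {C : ℝ} (hC : ∀ n, ‖U n‖ ≤ C)
    (h : TendstoWeakly (fun n => toL2 (U n)) (toL2 U')) : TendstoWeakly U U' := by
  -- Boundedness yields a weakly convergent subsequence in `H¹₀`. Its limit is recognised in `L²`,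
  -- where the underlying function determines the element.
  refine tendstoWeakly_of_subseq fun k hk => ?_
  obtain ⟨W, j, hj, hW⟩ := exists_subseq_tendstoWeakly fun n => hC (k n)
  refine ⟨j, ?_⟩
  have h1 := hW.map (toL2L Ω)
  have h2 := h.comp (hk.comp hj.tendsto_atTop)
  rwa [← toL2_injective hΩ (h1.unique h2)]

/-- A function is in `H¹₀(Ω)` if it is a weak limit in `L²(Ω)` of a bounded sequence of
`H¹₀(Ω)`. -/
theorem exists_toL2_eq_of_tendstoWeakly {U : ℕ → H10 Ω} {u : L2 Ω} {C : ℝ} (hC : ∀ n, ‖U n‖ ≤ C)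
    (h : TendstoWeakly (fun n => toL2 (U n)) u) : ∃ U' : H10 Ω, toL2 U' = u := by
  obtain ⟨W, j, hj, hW⟩ := exists_subseq_tendstoWeakly hC
  exact ⟨W, (hW.map (toL2L Ω)).unique (h.comp hj.tendsto_atTop)⟩

end DegenElliptic

/-! ### Rellich's theorem by Fourier transform -/

namespace DegenElliptic

variable {d : ℕ} {Ω : Set (Space d)}

open FourierTransform LineDeriv SchwartzMap

namespace IsTest

variable {φ : Space d → ℝ}

/-- A test function as a complex Schwartz function. -/
def schwartz (hφ : IsTest Ω φ) : SchwartzMap (Space d) ℂ :=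
  HasCompactSupport.toSchwartzMap (f := fun x => (φ x : ℂ))
    (hφ.compact.comp_left (g := fun r : ℝ => (r : ℂ)) Complex.ofReal_zero)
    (Complex.ofRealCLM.contDiff.comp hφ.smooth)

theorem schwartz_apply (hφ : IsTest Ω φ) (x : Space d) : hφ.schwartz x = φ x := rfl

theorem lineDeriv_schwartz (hφ : IsTest Ω φ) (v x : Space d) :
    (∂_{v} hφ.schwartz) x = ((inner ℝ (gradient φ x) v : ℝ) : ℂ) := by
  have h1 := (hφ.smooth.differentiable (by simp) x).hasFDerivAt
  have h2 : HasFDerivAt (fun x => (φ x : ℂ)) (Complex.ofRealCLM.comp (fderiv ℝ φ x)) x :=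
    Complex.ofRealCLM.hasFDerivAt.comp x h1
  have h3 : (∂_{v} hφ.schwartz) x = fderiv ℝ (fun x => (φ x : ℂ)) x v := rfl
  rw [h3, h2.fderiv, inner_gradient]
  rfl

/-- Plancherel's identity for the extension by zero. -/
theorem norm_sq_toL2 (hφ : IsTest Ω φ) :
    ‖toL2 hφ.toH10‖ ^ 2 = ∫ ξ, ‖𝓕 hφ.schwartz ξ‖ ^ 2 := by
  rw [integral_norm_sq_fourier, ← real_inner_self_eq_norm_sq, inner_L2_eq,
    ← setIntegral_eq_integral_of_forall_compl_eq_zero (s := Ω)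
      (f := fun x => ‖hφ.schwartz x‖ ^ 2) fun x hx => by
      rw [schwartz_apply, hφ.eq_zero_of_notMem hx]; simp]
  refine integral_congr_ae ?_
  filter_upwards [hφ.toL2_toH10] with x hx
  rw [hx, schwartz_apply]
  simp [sq]

theorem norm_sq_grad (hφ : IsTest Ω φ) :
    ‖grad hφ.toH10‖ ^ 2 = ∫ x, ‖gradient φ x‖ ^ 2 := by
  rw [← real_inner_self_eq_norm_sq, L2.inner_def,
    ← setIntegral_eq_integral_of_forall_compl_eq_zero (s := Ω)
      (f := fun x => ‖gradient φ x‖ ^ 2) fun x hx => by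
      rw [hφ.gradient_eq_zero_of_notMem hx]; simp]
  refine integral_congr_ae ?_
  filter_upwards [hφ.grad_toH10] with x hx
  rw [hx, real_inner_self_eq_norm_sq]

theorem integrable_norm_sq_schwartz (f : SchwartzMap (Space d) ℂ) :
    Integrable fun ξ => ‖f ξ‖ ^ 2 :=
  (f.memLp 2).integrable_norm_pow two_ne_zero

/-- The Fourier transform of a test function is small at high frequencies. -/
theorem integral_compl_closedBall_le (hφ : IsTest Ω φ) {R : ℝ} (hR : 0 < R) :
    ∫ ξ in (Metric.closedBall 0 R)ᶜ, ‖𝓕 hφ.schwartz ξ‖ ^ 2 ≤ ‖grad hφ.toH10‖ ^ 2 / R ^ 2 := by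
  let f := hφ.schwartz
  let e : Fin d → Space d := fun i => EuclideanSpace.single i 1
  have h1 : ∀ i ξ, ‖𝓕 (∂_{e i} f) ξ‖ ^ 2 = (2 * Real.pi) ^ 2 * (ξ i ^ 2 * ‖𝓕 f ξ‖ ^ 2) := by
    intro i ξ
    rw [SchwartzMap.fourier_lineDerivOp_eq]
    have : (inner ℝ · (e i) : Space d → ℝ).HasTemperateGrowth :=
      ((innerSL ℝ).flip (e i)).hasTemperateGrowth
    have h2 : inner ℝ ξ (e i) = ξ i := by simp [e, EuclideanSpace.inner_single_right]
    rw [_root_.smul_apply, SchwartzMap.smulLeftCLM_apply_apply this, h2]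
    simp only [norm_smul, norm_mul, Complex.norm_I, Complex.norm_real, Complex.norm_ofNat,
      mul_pow, Real.norm_eq_abs, sq_abs]
    ring
  -- Summing over the coordinates, the transformed gradient carries the weight `(2π)²‖ξ‖²`. Above
  -- radius `R` this is at least `R²`, the factor `(2π)² ≥ 1` being discarded.
  have h2 : ∀ ξ, ∑ i, ‖𝓕 (∂_{e i} f) ξ‖ ^ 2 = (2 * Real.pi) ^ 2 * (‖ξ‖ ^ 2 * ‖𝓕 f ξ‖ ^ 2) := by
    intro ξ
    simp_rw [h1]
    rw [← Finset.mul_sum, ← Finset.sum_mul, EuclideanSpace.norm_sq_eq]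
    simp
  have h3 : ∫ ξ, ∑ i, ‖𝓕 (∂_{e i} f) ξ‖ ^ 2 = ‖grad hφ.toH10‖ ^ 2 := by
    rw [integral_finsetSum _ fun i _ => integrable_norm_sq_schwartz _, norm_sq_grad]
    simp_rw [integral_norm_sq_fourier]
    rw [← integral_finsetSum _ fun i _ => integrable_norm_sq_schwartz _]
    refine integral_congr_ae (Eventually.of_forall fun x => ?_)
    simp only [f, lineDeriv_schwartz, e, Complex.norm_real]
    rw [EuclideanSpace.norm_sq_eq]
    refine Finset.sum_congr rfl fun i _ => ?_
    simp [EuclideanSpace.inner_single_right, -conj_trivial, -inner_gradient_left]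
  rw [le_div_iff₀ (by positivity), ← h3, mul_comm, ← integral_const_mul]
  have hint : Integrable fun ξ => ∑ i, ‖𝓕 (∂_{e i} f) ξ‖ ^ 2 :=
    integrable_finsetSum _ fun i _ => integrable_norm_sq_schwartz _
  refine le_trans (setIntegral_mono_on ((integrable_norm_sq_schwartz _).const_mul _).integrableOn
    hint.integrableOn Metric.isClosed_closedBall.measurableSet.compl fun ξ hξ => ?_)
    (setIntegral_le_integral hint (Eventually.of_forall fun ξ => by positivity))
  have hξ' : R < ‖ξ‖ := by simpa using hξ
  rw [h2]
  have hpi : 1 ≤ (2 * Real.pi) ^ 2 := by nlinarith [Real.pi_gt_three]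
  calc R ^ 2 * ‖𝓕 f ξ‖ ^ 2 ≤ ‖ξ‖ ^ 2 * ‖𝓕 f ξ‖ ^ 2 := by gcongr
    _ ≤ (2 * Real.pi) ^ 2 * (‖ξ‖ ^ 2 * ‖𝓕 f ξ‖ ^ 2) := le_mul_of_one_le_left (by positivity) hpi

end IsTest

/-- The Fourier transform as a pairing in `L²(Ω)`. -/
theorem exists_fourier_pairing [IsFiniteMeasure (volume.restrict Ω)] :
    ∃ K : ℝ, ∀ ξ : Space d, ∃ c s : L2 Ω, ‖c‖ ≤ K ∧ ‖s‖ ≤ K ∧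
      ∀ φ (hφ : IsTest Ω φ), 𝓕 hφ.schwartz ξ =
        ((inner ℝ c (toL2 hφ.toH10) : ℝ) : ℂ) + ((inner ℝ s (toL2 hφ.toH10) : ℝ) : ℂ) * Complex.I := by
  -- This is the square root of the measure of `Ω`. It bounds the `L²` norm of any function of
  -- modulus at most 1, uniformly in `ξ`.
  let K : ℝ := (measureUnivNNReal (volume.restrict Ω) : ℝ) ^ ((2 : ENNReal).toReal⁻¹) * 1
  refine ⟨K, fun ξ => ?_⟩
  let θ : Space d → ℝ := fun x => -2 * Real.pi * inner ℝ x ξ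
  have hθ : Continuous θ := by fun_prop
  have mc : MemLp (fun x => Real.cos (θ x)) 2 (volume.restrict Ω) :=
    MemLp.of_bound (Real.continuous_cos.comp hθ).aestronglyMeasurable 1
      (Eventually.of_forall fun x => Real.abs_cos_le_one _)
  have ms : MemLp (fun x => Real.sin (θ x)) 2 (volume.restrict Ω) :=
    MemLp.of_bound (Real.continuous_sin.comp hθ).aestronglyMeasurable 1
      (Eventually.of_forall fun x => Real.abs_sin_le_one _)
  refine ⟨mc.toLp _, ms.toLp _, ?_, ?_, fun φ hφ => ?_⟩
  · refine Lp.norm_le_of_ae_bound zero_le_one ?_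
    filter_upwards [mc.coeFn_toLp] with x hx
    rw [hx]; exact Real.abs_cos_le_one _
  · refine Lp.norm_le_of_ae_bound zero_le_one ?_
    filter_upwards [ms.coeFn_toLp] with x hx
    rw [hx]; exact Real.abs_sin_le_one _
  · rw [inner_L2_eq, inner_L2_eq, SchwartzMap.fourier_coe, Real.fourier_eq']
    have e1 : ∫ x in Ω, (mc.toLp _ : L2 Ω) x * toL2 hφ.toH10 x = ∫ x in Ω, Real.cos (θ x) * φ x :=
      integral_congr_ae (by filter_upwards [mc.coeFn_toLp, hφ.toL2_toH10] with x h1 h2; rw [h1, h2])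
    have e2 : ∫ x in Ω, (ms.toLp _ : L2 Ω) x * toL2 hφ.toH10 x = ∫ x in Ω, Real.sin (θ x) * φ x :=
      integral_congr_ae (by filter_upwards [ms.coeFn_toLp, hφ.toL2_toH10] with x h1 h2; rw [h1, h2])
    have i1 : Integrable (fun x => Real.cos (θ x) * φ x) (volume.restrict Ω) :=
      mc.integrable_mul hφ.memLp
    have i2 : Integrable (fun x => Real.sin (θ x) * φ x) (volume.restrict Ω) :=
      ms.integrable_mul hφ.memLp
    rw [e1, e2, ← integral_complex_ofReal, ← integral_complex_ofReal, ← integral_mul_const,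
      ← integral_add i1.ofReal (i2.ofReal.mul_const _),
      ← setIntegral_eq_integral_of_forall_compl_eq_zero (s := Ω) fun x hx => by
        rw [IsTest.schwartz_apply, hφ.eq_zero_of_notMem hx]; simp]
    refine integral_congr_ae (Eventually.of_forall fun x => ?_)
    simp only [IsTest.schwartz_apply]
    have : ((-2 * Real.pi * inner ℝ x ξ : ℝ) : ℂ) = (θ x : ℂ) := rfl
    rw [this, Complex.exp_mul_I, smul_eq_mul, ← Complex.ofReal_cos, ← Complex.ofReal_sin]
    push_cast
    ring

/-- Compactness of the embedding of `H¹₀(Ω)` in `L²(Ω)`, for test functions. -/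
theorem tendsto_toL2_of_isTest [IsFiniteMeasure (volume.restrict Ω)] {φ : ℕ → Space d → ℝ}
    (hφ : ∀ n, IsTest Ω (φ n)) {C : ℝ} (hC : ∀ n, ‖(hφ n).toH10‖ ≤ C)
    (h : TendstoWeakly (fun n => toL2 (hφ n).toH10) 0) :
    Tendsto (fun n => ‖toL2 (hφ n).toH10‖ ^ 2) atTop (𝓝 0) := by
  have hC0 : 0 ≤ C := (norm_nonneg _).trans (hC 0)
  obtain ⟨K, hK⟩ := exists_fourier_pairing (Ω := Ω)
  have hK0 : 0 ≤ K := by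
    obtain ⟨c, _, hc, -⟩ := hK 0
    exact (norm_nonneg _).trans hc
  -- Evaluating the transform at `ξ` is a pairing with fixed elements of `L²(Ω)`, so weak
  -- convergence in `L²` gives pointwise convergence of the transforms.
  have hpt : ∀ ξ, Tendsto (fun n => ‖𝓕 (hφ n).schwartz ξ‖ ^ 2) atTop (𝓝 0) := by
    intro ξ
    obtain ⟨c, s, -, -, hcs⟩ := hK ξ
    have h1 := h.clm (innerSL ℝ c)
    have h2 := h.clm (innerSL ℝ s)
    simp only [innerSL_apply_apply, inner_zero_right] at h1 h2
    have h3 := (((Complex.continuous_ofReal.tendsto _).comp h1).add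
      (((Complex.continuous_ofReal.tendsto _).comp h2).mul_const Complex.I)).norm.pow 2
    simpa [hcs] using h3
  have hbd : ∀ n ξ, ‖𝓕 (hφ n).schwartz ξ‖ ^ 2 ≤ (2 * (K * C)) ^ 2 := by
    intro n ξ
    obtain ⟨c, s, hc, hs, hcs⟩ := hK ξ
    have hn : ‖toL2 (hφ n).toH10‖ ≤ C := (norm_toL2_le _).trans (hC n)
    have hb : ∀ c : L2 Ω, ‖c‖ ≤ K → |inner ℝ c (toL2 (hφ n).toH10)| ≤ K * C := fun c hc =>
      (abs_real_inner_le_norm _ _).trans (mul_le_mul hc hn (norm_nonneg _) hK0)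
    rw [hcs]
    refine pow_le_pow_left₀ (norm_nonneg _) ((norm_add_le _ _).trans ?_) 2
    simp only [norm_mul, Complex.norm_real, Complex.norm_I, mul_one, Real.norm_eq_abs]
    linarith [hb c hc, hb s hs]
  refine Metric.tendsto_atTop.2 fun ε hε => ?_
  -- The radius makes the high-frequency tail `C²/R²` smaller than `ε/2`. The added 1 gives the
  -- strict inequality and `R > 0`.
  let R : ℝ := Real.sqrt (2 * C ^ 2 / ε) + 1
  have hR : 0 < R := by positivity
  have hR2 : C ^ 2 / R ^ 2 < ε / 2 := by
    have h1 : 2 * C ^ 2 / ε < R ^ 2 := by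
      have := Real.sq_sqrt (show 0 ≤ 2 * C ^ 2 / ε by positivity)
      have h0 := Real.sqrt_nonneg (2 * C ^ 2 / ε)
      simp only [R]; nlinarith
    rw [div_lt_iff₀ hε] at h1
    rw [div_lt_iff₀ (by positivity)]
    linarith
  have hlow : Tendsto (fun n => ∫ ξ in Metric.closedBall 0 R, ‖𝓕 (hφ n).schwartz ξ‖ ^ 2) atTop
      (𝓝 0) := by
    have := tendsto_integral_of_dominated_convergence
      (μ := volume.restrict (Metric.closedBall (0 : Space d) R))
      (F := fun n ξ => ‖𝓕 (hφ n).schwartz ξ‖ ^ 2) (f := fun _ => 0)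
      (fun _ => (2 * (K * C)) ^ 2)
      (fun n => (IsTest.integrable_norm_sq_schwartz _).aestronglyMeasurable.restrict)
      (integrableOn_const (isCompact_closedBall _ _).measure_lt_top.ne)
      (fun n => Eventually.of_forall fun ξ => by
        rw [Real.norm_of_nonneg (by positivity)]; exact hbd n ξ)
      (Eventually.of_forall hpt)
    simpa using this
  obtain ⟨N, hN⟩ := Metric.tendsto_atTop.1 hlow (ε / 2) (by positivity)
  refine ⟨N, fun n hn => ?_⟩
  have h1 := hN n hn
  rw [Real.dist_0_eq_abs] at h1 ⊢
  have h2 := lt_of_abs_lt h1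
  rw [abs_of_nonneg (by positivity), IsTest.norm_sq_toL2, ← integral_add_compl
    (Metric.isClosed_closedBall (x := (0 : Space d)) (ε := R)).measurableSet
    (IsTest.integrable_norm_sq_schwartz _)]
  have h3 := (hφ n).integral_compl_closedBall_le hR
  have h4 : ‖grad (hφ n).toH10‖ ^ 2 / R ^ 2 ≤ C ^ 2 / R ^ 2 := by
    gcongr
    exact (norm_grad_le _).trans (hC n)
  linarith

/-- **Rellich's theorem**: the embedding of `H¹₀(Ω)` in `L²(Ω)` is compact. -/
theorem tendsto_toL2_of_tendstoWeakly [IsFiniteMeasure (volume.restrict Ω)] {U : ℕ → H10 Ω}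
    {U' : H10 Ω} {C : ℝ} (hC : ∀ n, ‖U n‖ ≤ C) (h : TendstoWeakly U U') :
    Tendsto (fun n => toL2 (U n)) atTop (𝓝 (toL2 U')) := by
  have hε : ∀ n : ℕ, (0 : ℝ) < 1 / (n + 1) := fun n => by positivity
  -- Replacing `U n - U'` by a test function within `1/(n+1)` reduces the claim to test functions
  -- converging weakly to zero.
  choose φ hφ hU using fun n => exists_toH10_dist_lt (U n - U') (hε n)
  have hz : Tendsto (fun n => (U n - U') - (hφ n).toH10) atTop (𝓝 0) :=
    squeeze_zero_norm (fun n => (hU n).le) tendsto_one_div_add_atTop_nhds_zero_nat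
  have hw : TendstoWeakly (fun n => (hφ n).toH10) 0 := by
    have h1 := (h.sub (tendstoWeakly_of_tendsto (tendsto_const_nhds (x := U')))).sub
      (tendstoWeakly_of_tendsto hz)
    simpa using h1
  have hb : ∀ n, ‖(hφ n).toH10‖ ≤ C + ‖U'‖ + 1 := by
    intro n
    have h1 : (hφ n).toH10 = (U n - U') - ((U n - U') - (hφ n).toH10) := by abel
    have h2 : (1 : ℝ) / (n + 1) ≤ 1 := by
      rw [div_le_one (by positivity)]; linarith [Nat.cast_nonneg (α := ℝ) n]
    rw [h1]
    refine (norm_sub_le _ _).trans (add_le_add ((norm_sub_le _ _).trans ?_) ((hU n).le.trans h2))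
    gcongr
    exact hC n
  have h3 := tendsto_toL2_of_isTest hφ hb (hw.map (toL2L Ω))
  have h4 : Tendsto (fun n => toL2 (hφ n).toH10) atTop (𝓝 0) := by
    rw [tendsto_zero_iff_norm_tendsto_zero]
    simpa using h3.sqrt
  have h5 := ((toL2L Ω).continuous.tendsto _).comp hz
  have h6 := (h4.add h5).add_const (toL2 U')
  simp only [map_zero, add_zero, zero_add] at h6
  refine h6.congr fun n => ?_
  simp only [Function.comp_apply, toL2L_apply, toL2_sub]
  abel

end DegenElliptic

/-! ### The chain rule for bounded Borel derivatives -/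

namespace DegenElliptic

theorem norm_sq_Lp_two {α E : Type*} [MeasurableSpace α] {m : Measure α} [NormedAddCommGroup E]
    [InnerProductSpace ℝ E] (F : Lp E 2 m) : ‖F‖ ^ 2 = ∫ x, ‖F x‖ ^ 2 ∂m := by
  rw [← real_inner_self_eq_norm_sq, L2.inner_def]
  simp_rw [real_inner_self_eq_norm_sq]

/-- Dominated convergence in `L²`. -/
theorem tendsto_Lp_two_of_dominated {α E : Type*} [MeasurableSpace α] {m : Measure α}
    [NormedAddCommGroup E] [InnerProductSpace ℝ E] {F : ℕ → Lp E 2 m} {F' : Lp E 2 m}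
    {g : α → ℝ} (hg : MemLp g 2 m) (hb : ∀ n, ∀ᵐ x ∂m, ‖F n x - F' x‖ ≤ g x)
    (h : ∀ᵐ x ∂m, Tendsto (fun n => F n x) atTop (𝓝 (F' x))) : Tendsto F atTop (𝓝 F') := by
  rw [tendsto_iff_norm_sub_tendsto_zero]
  have h1 : Tendsto (fun n => ‖F n - F'‖ ^ 2) atTop (𝓝 0) := by
    have h2 : ∀ n, ‖F n - F'‖ ^ 2 = ∫ x, ‖F n x - F' x‖ ^ 2 ∂m := by
      intro n
      rw [norm_sq_Lp_two]
      refine integral_congr_ae ?_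
      filter_upwards [Lp.coeFn_sub (F n) F'] with x hx
      rw [hx, Pi.sub_apply]
    simp_rw [h2]
    rw [← integral_zero α ℝ (μ := m)]
    refine tendsto_integral_of_dominated_convergence (fun x => g x ^ 2) (fun n => ?_)
      hg.integrable_sq (fun n => ?_) ?_
    · exact (((Lp.aestronglyMeasurable (F n)).sub (Lp.aestronglyMeasurable F')).norm).pow 2
    · filter_upwards [hb n] with x hx
      rw [Real.norm_of_nonneg (by positivity)]
      gcongr
    · filter_upwards [h] with x hx
      have := ((hx.sub_const (F' x)).norm).pow 2
      simpa using this
  simpa using h1.sqrt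

variable {d : ℕ} {Ω : Set (Space d)}

/-- `H¹₀(Ω)` is closed. -/
theorem exists_of_tendsto {U : ℕ → H10 Ω} {a : L2 Ω} {b : L2Vec Ω}
    (ha : Tendsto (fun n => toL2 (U n)) atTop (𝓝 a))
    (hb : Tendsto (fun n => grad (U n)) atTop (𝓝 b)) :
    ∃ W : H10 Ω, toL2 W = a ∧ grad W = b := by
  have h1 : Tendsto (fun n => (U n : WithLp 2 (L2 Ω × L2Vec Ω))) atTop
      (𝓝 (WithLp.toLp 2 (a, b))) :=
    ((WithLp.prod_continuous_toLp 2 (L2 Ω) (L2Vec Ω)).tendsto (a, b)).comp (ha.prodMk_nhds hb)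
  exact ⟨⟨_, (testPairs Ω).isClosed_topologicalClosure.mem_of_tendsto h1
    (Eventually.of_forall fun n => (U n).2)⟩, rfl, rfl⟩

/-- `∫₀^w h` is in `H¹₀(Ω)`, with gradient `h(w) ∇w`. -/
structure PrimComp (w : H10 Ω) (h : ℝ → ℝ) : Prop where
  measurable : Measurable h
  bounded : ∃ C, ∀ s, ‖h s‖ ≤ C
  exists_comp : ∃ U : H10 Ω,
    (∀ᵐ x ∂(volume.restrict Ω), toL2 U x = ∫ r in (0 : ℝ)..toL2 w x, h r) ∧
    ∀ᵐ x ∂(volume.restrict Ω), grad U x = h (toL2 w x) • grad w x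

theorem intervalIntegrable_of_bounded {h : ℝ → ℝ} (hm : Measurable h) {C : ℝ}
    (hC : ∀ s, ‖h s‖ ≤ C) (a b : ℝ) : IntervalIntegrable h volume a b :=
  (intervalIntegrable_const (c := C)).mono_fun hm.aestronglyMeasurable
    (Eventually.of_forall fun s => (hC s).trans (le_abs_self C))

theorem norm_intervalIntegral_sub_le {h : ℝ → ℝ} (hm : Measurable h) {C : ℝ}
    (hC : ∀ s, ‖h s‖ ≤ C) (a b : ℝ) :
    ‖(∫ r in (0 : ℝ)..a, h r) - ∫ r in (0 : ℝ)..b, h r‖ ≤ C * |a - b| := by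
  rw [intervalIntegral.integral_interval_sub_left (intervalIntegrable_of_bounded hm hC _ _)
    (intervalIntegrable_of_bounded hm hC _ _)]
  exact intervalIntegral.norm_integral_le_of_norm_le_const fun x _ => hC x

theorem norm_intervalIntegral_le {h : ℝ → ℝ} {C : ℝ} (hC : ∀ s, ‖h s‖ ≤ C) (a : ℝ) :
    ‖∫ r in (0 : ℝ)..a, h r‖ ≤ C * |a| := by
  simpa using intervalIntegral.norm_integral_le_of_norm_le_const (a := 0) (b := a)
    (f := h) fun x _ => hC x

theorem memLp_prim (u : L2 Ω) {h : ℝ → ℝ} (hm : Measurable h) {C : ℝ} (hC : ∀ s, ‖h s‖ ≤ C) :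
    MemLp (fun x => ∫ r in (0 : ℝ)..u x, h r) 2 (volume.restrict Ω) := by
  refine (Lp.memLp u).of_le_mul (c := C) ?_
    (Eventually.of_forall fun x => norm_intervalIntegral_le hC _)
  exact (intervalIntegral.continuous_primitive
    (intervalIntegrable_of_bounded hm hC) 0).comp_aestronglyMeasurable (Lp.aestronglyMeasurable u)

theorem memLp_comp_smul (u : L2 Ω) (G : L2Vec Ω) {h : ℝ → ℝ} (hm : Measurable h) {C : ℝ}
    (hC : ∀ s, ‖h s‖ ≤ C) : MemLp (fun x => h (u x) • G x) 2 (volume.restrict Ω) := by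
  refine (Lp.memLp G).of_le_mul (c := C) ?_ (Eventually.of_forall fun x => ?_)
  · exact (hm.comp_aemeasurable (Lp.aestronglyMeasurable u).aemeasurable).aestronglyMeasurable.smul
      (Lp.aestronglyMeasurable G)
  · rw [norm_smul]
    exact mul_le_mul_of_nonneg_right (hC _) (norm_nonneg _)

namespace PrimComp

variable {w : H10 Ω} {h h' : ℝ → ℝ}

theorem add (H : PrimComp w h) (H' : PrimComp w h') : PrimComp w (h + h') := by
  obtain ⟨C, hC⟩ := H.bounded
  obtain ⟨C', hC'⟩ := H'.bounded
  obtain ⟨U, h1, h2⟩ := H.exists_comp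
  obtain ⟨U', h1', h2'⟩ := H'.exists_comp
  refine ⟨H.measurable.add H'.measurable, ⟨C + C', fun s => (norm_add_le _ _).trans
    (add_le_add (hC s) (hC' s))⟩, U + U', ?_, ?_⟩
  · filter_upwards [h1, h1', Lp.coeFn_add (toL2 U) (toL2 U')] with x e e' e''
    rw [toL2_add, e'', Pi.add_apply, e, e']
    exact (intervalIntegral.integral_add (intervalIntegrable_of_bounded H.measurable hC _ _)
      (intervalIntegrable_of_bounded H'.measurable hC' _ _)).symm
  · filter_upwards [h2, h2', Lp.coeFn_add (grad U) (grad U')] with x e e' e''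
    rw [grad_add, e'', Pi.add_apply, e, e', Pi.add_apply, add_smul]

theorem const_smul (H : PrimComp w h) (c : ℝ) : PrimComp w (c • h) := by
  obtain ⟨C, hC⟩ := H.bounded
  obtain ⟨U, h1, h2⟩ := H.exists_comp
  refine ⟨H.measurable.const_smul c, ⟨‖c‖ * C, fun s => ?_⟩, c • U, ?_, ?_⟩
  · rw [Pi.smul_apply, norm_smul]
    exact mul_le_mul_of_nonneg_left (hC s) (norm_nonneg c)
  · filter_upwards [h1, Lp.coeFn_smul c (toL2 U)] with x e e'
    rw [toL2_smul, e', Pi.smul_apply, e]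
    exact (intervalIntegral.integral_smul c h).symm
  · filter_upwards [h2, Lp.coeFn_smul c (grad U)] with x e e'
    rw [grad_smul, e', Pi.smul_apply, e, Pi.smul_apply, smul_assoc]

/-- Bounded pointwise limits preserve the chain rule. -/
theorem of_tendsto {g : ℕ → ℝ → ℝ} (H : ∀ k, PrimComp w (g k)) {C : ℝ}
    (hC : ∀ k s, ‖g k s‖ ≤ C) (hlim : ∀ s, Tendsto (fun k => g k s) atTop (𝓝 (h s))) :
    PrimComp w h := by
  have hm : Measurable h := measurable_of_tendsto_metrizable (fun k => (H k).measurable)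
    (tendsto_pi_nhds.2 hlim)
  have hCh : ∀ s, ‖h s‖ ≤ C := fun s =>
    le_of_tendsto ((hlim s).norm) (Eventually.of_forall fun k => hC k s)
  refine ⟨hm, ⟨C, hCh⟩, ?_⟩
  choose U hU1 hU2 using fun k => (H k).exists_comp
  have m1 := memLp_prim (toL2 w) hm hCh
  have m2 := memLp_comp_smul (toL2 w) (grad w) hm hCh
  -- Since `H¹₀` is closed in the product space, it suffices that values and gradients converge
  -- separately in `L²`.
  have key := exists_of_tendsto (U := U) (a := m1.toLp _) (b := m2.toLp _)
  refine (key ?_ ?_).imp fun W hW =>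
    ⟨by rw [hW.1]; exact m1.coeFn_toLp, by rw [hW.2]; exact m2.coeFn_toLp⟩
  · refine tendsto_Lp_two_of_dominated ((Lp.memLp (toL2 w)).norm.const_mul (2 * C))
      (fun k => ?_) ?_
    · filter_upwards [hU1 k, m1.coeFn_toLp] with x e1 e2
      rw [e1, e2, Real.norm_eq_abs (toL2 w x)]
      refine (norm_sub_le _ _).trans ?_
      linarith [norm_intervalIntegral_le (hC k) (toL2 w x),
        norm_intervalIntegral_le hCh (toL2 w x)]
    · filter_upwards [ae_all_iff.2 hU1, m1.coeFn_toLp] with x e1 e2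
      simp_rw [e1, e2]
      exact intervalIntegral.tendsto_integral_filter_of_dominated_convergence (fun _ => C)
        (Eventually.of_forall fun k => (H k).measurable.aestronglyMeasurable)
        (Eventually.of_forall fun k => Eventually.of_forall fun s _ => hC k s)
        intervalIntegrable_const (Eventually.of_forall fun s _ => hlim s)
  · refine tendsto_Lp_two_of_dominated ((Lp.memLp (grad w)).norm.const_mul (2 * C))
      (fun k => ?_) ?_
    · filter_upwards [hU2 k, m2.coeFn_toLp] with x e1 e2
      rw [e1, e2, ← sub_smul, norm_smul]
      refine mul_le_mul_of_nonneg_right ?_ (norm_nonneg _)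
      refine (norm_sub_le _ _).trans ?_
      linarith [hC k (toL2 w x), hCh (toL2 w x)]
    · filter_upwards [ae_all_iff.2 hU2, m2.coeFn_toLp] with x e1 e2
      simp_rw [e1, e2]
      exact (hlim _).smul_const _

end PrimComp

theorem gradient_comp {φ : Space d → ℝ} {G : ℝ → ℝ} {x : Space d} {g : ℝ}
    (hφ : DifferentiableAt ℝ φ x) (hG : HasDerivAt G g (φ x)) :
    gradient (fun y => G (φ y)) x = g • gradient φ x := by
  have h1 : HasFDerivAt (fun y => G (φ y)) (g • fderiv ℝ φ x) x :=
    hG.comp_hasFDerivAt x hφ.hasFDerivAt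
  rw [gradient, h1.fderiv, map_smul, gradient]

/-- Elements of `H¹₀(Ω)` are limits of test functions, also almost everywhere. -/
theorem exists_seq_toH10_tendsto (w : H10 Ω) :
    ∃ (φ : ℕ → Space d → ℝ) (hφ : ∀ n, IsTest Ω (φ n)),
      Tendsto (fun n => toL2 (hφ n).toH10) atTop (𝓝 (toL2 w)) ∧
      Tendsto (fun n => grad (hφ n).toH10) atTop (𝓝 (grad w)) ∧
      ∀ᵐ x ∂(volume.restrict Ω),
        Tendsto (fun n => toL2 (hφ n).toH10 x) atTop (𝓝 (toL2 w x)) := by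
  have hεpos : ∀ n : ℕ, (0 : ℝ) < 1 / (n + 1) := fun n => by positivity
  choose φ hφ hw using fun n => exists_toH10_dist_lt w (hεpos n)
  have hlim : Tendsto (fun n => (hφ n).toH10) atTop (𝓝 w) := by
    rw [tendsto_iff_norm_sub_tendsto_zero]
    exact squeeze_zero (fun n => norm_nonneg _) (fun n => by rw [norm_sub_rev]; exact (hw n).le)
      tendsto_one_div_add_atTop_nhds_zero_nat
  have h1 : Tendsto (fun n => toL2 (hφ n).toH10) atTop (𝓝 (toL2 w)) :=
    ((toL2L Ω).continuous.tendsto w).comp hlim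
  have h2 : Tendsto (fun n => grad (hφ n).toH10) atTop (𝓝 (grad w)) :=
    ((gradL Ω).continuous.tendsto w).comp hlim
  obtain ⟨k, hk, hae⟩ := (tendstoInMeasure_of_tendsto_Lp h1).exists_seq_tendsto_ae
  exact ⟨fun n => φ (k n), fun n => hφ (k n), h1.comp hk.tendsto_atTop,
    h2.comp hk.tendsto_atTop, hae⟩

/-- Continuity of `(u, G) ↦ h(u) G` in `L²`. -/
theorem tendsto_comp_smul {h : ℝ → ℝ} (hh : Continuous h) {C : ℝ} (hC : ∀ s, ‖h s‖ ≤ C)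
    {u : ℕ → L2 Ω} {u' : L2 Ω} {F G : ℕ → L2Vec Ω} {F' G' : L2Vec Ω}
    (hu : ∀ᵐ x ∂(volume.restrict Ω), Tendsto (fun n => u n x) atTop (𝓝 (u' x)))
    (hG : Tendsto G atTop (𝓝 G'))
    (hF : ∀ n, ∀ᵐ x ∂(volume.restrict Ω), F n x = h (u n x) • G n x)
    (hF' : ∀ᵐ x ∂(volume.restrict Ω), F' x = h (u' x) • G' x) : Tendsto F atTop (𝓝 F') := by
  have hm := hh.measurable
  -- The intermediate sequence `h(uₙ) G'` converges by dominated convergence. The remainder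
  -- `h(uₙ)(Gₙ - G')` is at most `C‖Gₙ - G'‖`.
  have m3 : ∀ n, MemLp (fun x => h (u n x) • G' x) 2 (volume.restrict Ω) :=
    fun n => memLp_comp_smul _ _ hm hC
  have h1 : Tendsto (fun n => (m3 n).toLp _) atTop (𝓝 F') := by
    refine tendsto_Lp_two_of_dominated ((Lp.memLp G').norm.const_mul (2 * C))
      (fun n => ?_) ?_
    · filter_upwards [(m3 n).coeFn_toLp, hF'] with x e1 e2
      rw [e1, e2, ← sub_smul, norm_smul]
      refine mul_le_mul_of_nonneg_right ?_ (norm_nonneg _)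
      refine (norm_sub_le _ _).trans ?_
      linarith [hC (u n x), hC (u' x)]
    · filter_upwards [ae_all_iff.2 fun n => (m3 n).coeFn_toLp, hF', hu] with x e1 e2 e3
      simp_rw [e1, e2]
      exact ((hh.tendsto _).comp e3).smul_const _
  have h2 : Tendsto (fun n => F n - (m3 n).toLp _) atTop (𝓝 0) := by
    rw [tendsto_iff_norm_sub_tendsto_zero] at hG
    refine squeeze_zero_norm (fun n => ?_) (by simpa using hG.const_mul C)
    refine Lp.norm_le_mul_norm_of_ae_le_mul ?_
    filter_upwards [Lp.coeFn_sub (F n) ((m3 n).toLp _), (m3 n).coeFn_toLp, hF n,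
      Lp.coeFn_sub (G n) G'] with x e1 e2 e3 e4
    rw [e1, e4, Pi.sub_apply, Pi.sub_apply, e2, e3, ← smul_sub, norm_smul]
    exact mul_le_mul_of_nonneg_right (hC _) (norm_nonneg _)
  simpa using h2.add h1

/-- The chain rule for smooth functions with bounded derivative. -/
theorem primComp_of_contDiff (w : H10 Ω) {h : ℝ → ℝ} (hh : ContDiff ℝ ∞ h) {C : ℝ}
    (hC : ∀ s, ‖h s‖ ≤ C) : PrimComp w h := by
  have hm : Measurable h := hh.continuous.measurable
  refine ⟨hm, ⟨C, hC⟩, ?_⟩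
  let G : ℝ → ℝ := fun s => ∫ r in (0 : ℝ)..s, h r
  have hGd : ∀ s, HasDerivAt G (h s) s := fun s =>
    intervalIntegral.integral_hasDerivAt_right (hh.continuous.intervalIntegrable _ _)
      (hh.continuous.stronglyMeasurableAtFilter _ _) hh.continuous.continuousAt
  have hG : ContDiff ℝ ∞ G := by
    refine contDiff_infty_iff_deriv.2 ⟨fun s => (hGd s).differentiableAt, ?_⟩
    rwa [show deriv G = h from funext fun s => (hGd s).deriv]
  have hG0 : G 0 = 0 := intervalIntegral.integral_same
  obtain ⟨φ, hφ, hlim1, hlim2, hae⟩ := exists_seq_toH10_tendsto w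
  -- Because `G 0 = 0`, composition does not enlarge the support, so `G ∘ φₙ` is again a test
  -- function.
  have hT : ∀ n, IsTest Ω (fun x => G (φ n x)) := fun n =>
    ⟨hG.comp (hφ n).smooth, (hφ n).compact.comp_left hG0,
      (closure_mono fun x (hx : G (φ n x) ≠ 0) (hx0 : φ n x = 0) =>
        hx (by rw [hx0, hG0])).trans (hφ n).supp⟩
  have m1 := memLp_prim (toL2 w) hm hC
  have m2 := memLp_comp_smul (toL2 w) (grad w) hm hC
  have key := exists_of_tendsto (U := fun n => (hT n).toH10) (a := m1.toLp _) (b := m2.toLp _)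
  refine (key ?_ ?_).imp fun W hW =>
    ⟨by rw [hW.1]; exact m1.coeFn_toLp, by rw [hW.2]; exact m2.coeFn_toLp⟩
  · rw [tendsto_iff_norm_sub_tendsto_zero] at hlim1 ⊢
    refine squeeze_zero (fun n => norm_nonneg _) (fun n => ?_) (by simpa using hlim1.const_mul C)
    refine Lp.norm_le_mul_norm_of_ae_le_mul ?_
    filter_upwards [Lp.coeFn_sub (toL2 (hT n).toH10) (m1.toLp _), m1.coeFn_toLp,
      (hT n).toL2_toH10, (hφ n).toL2_toH10, Lp.coeFn_sub (toL2 (hφ n).toH10) (toL2 w)]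
      with x e1 e2 e3 e4 e5
    rw [e1, e5, Pi.sub_apply, Pi.sub_apply, e2, e3, e4]
    exact norm_intervalIntegral_sub_le hm hC _ _
  · refine tendsto_comp_smul hh.continuous hC hae hlim2 (fun n => ?_) m2.coeFn_toLp
    filter_upwards [(hT n).grad_toH10, (hφ n).toL2_toH10, (hφ n).grad_toH10] with x e3 e4 e5
    rw [e3, e4, e5, gradient_comp ((hφ n).smooth.differentiable (by simp) x) (hGd _)]

/-- Smooth transitions of width `1/k` placed to the left of `a` converge at every point. At `s = a`
they vanish exactly, as does the indicator of the open half-line. -/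
theorem primComp_indicator_Iio (w : H10 Ω) (a : ℝ) :
    PrimComp w ((Set.Iio a).indicator fun _ => 1) := by
  refine PrimComp.of_tendsto (g := fun k s => Real.smoothTransition (k * (a - s))) (C := 1)
    (fun k => primComp_of_contDiff w (C := 1) ?_ fun s => ?_) (fun k s => ?_) fun s => ?_
  · exact Real.smoothTransition.contDiff.comp (by fun_prop)
  · rw [Real.norm_of_nonneg (Real.smoothTransition.nonneg _)]
    exact Real.smoothTransition.le_one _
  · rw [Real.norm_of_nonneg (Real.smoothTransition.nonneg _)]
    exact Real.smoothTransition.le_one _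
  · by_cases hs : s < a
    · rw [Set.indicator_of_mem (Set.mem_Iio.2 hs)]
      have h1 : Tendsto (fun k : ℕ => (k : ℝ) * (a - s)) atTop atTop :=
        tendsto_natCast_atTop_atTop.atTop_mul_const (sub_pos.2 hs)
      refine tendsto_const_nhds.congr' ?_
      filter_upwards [h1.eventually_ge_atTop 1] with k hk
      exact (Real.smoothTransition.one_of_one_le hk).symm
    · rw [Set.indicator_of_notMem (by simpa using hs)]
      refine tendsto_const_nhds.congr fun k => (Real.smoothTransition.zero_of_nonpos ?_).symm
      exact mul_nonpos_of_nonneg_of_nonpos (Nat.cast_nonneg k) (by linarith)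

/-- A π-λ argument: the sets whose indicator obeys the chain rule contain the half-lines `Iio a`,
and are stable under complements and countable disjoint unions. The derivative of `μ`, which may be
discontinuous, thus becomes accessible without studying `∇w` on level sets. -/
theorem primComp_indicator (w : H10 Ω) {s : Set ℝ} (hs : MeasurableSet s) :
    PrimComp w (s.indicator fun _ => 1) := by
  have hone : PrimComp w fun _ => 1 := primComp_of_contDiff w contDiff_const (C := 1) (by simp)
  have hzero : PrimComp w fun _ => 0 := by
    have := hone.const_smul 0
    rwa [zero_smul] at this
  induction s, hs using MeasurableSpace.induction_on_inter
    (borel_eq_generateFrom_Iio ℝ ▸ (BorelSpace.measurable_eq (α := ℝ))) isPiSystem_Iio with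
  | empty => simpa using hzero
  | basic t ht => obtain ⟨a, rfl⟩ := ht; exact primComp_indicator_Iio w a
  | compl t ht ih =>
    have : (tᶜ.indicator fun _ => 1 : ℝ → ℝ) = (fun _ => 1) + (-1 : ℝ) • t.indicator fun _ => 1 := by
      ext x
      by_cases hx : x ∈ t <;> simp [hx]
    rw [this]
    exact hone.add (ih.const_smul _)
  | iUnion f hd hf ih =>
    let S : ℕ → Set ℝ := fun n => ⋃ i ∈ Finset.range n, f i
    have hS : ∀ n, PrimComp w ((S n).indicator fun _ => 1) := by
      intro n
      induction n with
      | zero => simpa [S] using hzero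
      | succ n ihn =>
        have h1 : S (n + 1) = f n ∪ S n := by
          simp only [S, Finset.range_add_one, Finset.set_biUnion_insert]
        have h2 : Disjoint (f n) (S n) := by
          simp only [S, Set.disjoint_iUnion_right]
          intro i hi
          exact hd (by have := Finset.mem_range.1 hi; omega)
        rw [h1, Set.indicator_union_of_disjoint h2]
        exact (ih n).add ihn
    have hmono : Monotone S := fun a b hab =>
      Set.biUnion_subset_biUnion_left fun i hi => by
        simp only [Finset.mem_range, Finset.mem_coe] at hi ⊢; omega
    have hU : ⋃ n, S n = ⋃ i, f i := by
      ext x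
      simp only [S, Set.mem_iUnion, Finset.mem_range, exists_prop]
      exact ⟨fun ⟨n, i, _, hx⟩ => ⟨i, hx⟩, fun ⟨i, hx⟩ => ⟨i + 1, i, by omega, hx⟩⟩
    refine PrimComp.of_tendsto hS (C := 1) (fun n x => ?_) fun x => ?_
    · by_cases hx : x ∈ S n <;> simp [hx]
    · rw [← hU]
      exact (hmono.tendsto_indicator S (fun _ => (1 : ℝ)) x).mono_right (pure_le_nhds _)

/-- **Chain rule**: for `h` bounded and measurable, `∫₀^w h` is in `H¹₀(Ω)`, with gradient
`h(w) ∇w`. -/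
theorem primComp (w : H10 Ω) {h : ℝ → ℝ} (hm : Measurable h) {C : ℝ} (hC : ∀ s, ‖h s‖ ≤ C) :
    PrimComp w h := by
  have hsimple : ∀ g : SimpleFunc ℝ ℝ, PrimComp w g := by
    intro g
    induction g using SimpleFunc.induction with
    | const c hs =>
      rename_i s
      have h1 := (primComp_indicator w hs).const_smul c
      convert h1 using 1
      ext x
      by_cases hx : x ∈ s <;> simp [hx]
    | add _ h1 h2 => exact h1.add h2
  have hsm := hm.stronglyMeasurable
  have hC0 : 0 ≤ C := (norm_nonneg _).trans (hC 0)
  exact PrimComp.of_tendsto (fun n => hsimple (hsm.approxBounded C n))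
    (fun n s => hsm.norm_approxBounded_le hC0 n s)
    fun s => hsm.tendsto_approxBounded_of_norm_le (hC s)

end DegenElliptic

/-! ### The scalar functions `μ`, `ρ` and `ν` -/

namespace DegenElliptic

/-- The properties of the function `μ`. -/
structure Admissible (m : ℝ → ℝ) : Prop where
  mono : Monotone m
  sub_le : ∀ s t, s ≤ t → m t - m s ≤ t - s
  zero : m 0 = 0
  growth : ∃ A B : ℝ, 0 ≤ A ∧ 0 ≤ B ∧ ∀ t, |t| ≤ A * |m t| + B

/-- With `g = (β + ζ)⁻¹` one has `t - μ(t) = β(g(t))`, so the increments of `μ` are controlled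
because `β ∘ g` is non-decreasing. For the growth, `|ζ(g t)|` controls `|g t|`, which controls `|β(g
t)|`, hence `|t|`. -/
theorem admissible_mu (β ζ : ℝ → ℝ)
    (hζ : Continuous ζ) (hζm : Monotone ζ) (hζ0 : ζ 0 = 0)
    (hζg : ∃ M₀ > 0, ∃ M₁ > 0, ∀ s : ℝ, M₀ * |s| - M₁ ≤ |ζ s|)
    (hβ : Continuous β) (hβm : Monotone β) (hβ0 : β 0 = 0)
    (hβg : ∃ K₀ > 0, ∃ K₁ > 0, ∀ s : ℝ, |β s| ≤ K₀ * |s| + K₁)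
    (hinc : StrictMono fun s => β s + ζ s) : Admissible (mu β ζ) := by
  have hbij := bijective_add β ζ hβ hβm hβ0 hζ hζm hζ0 hζg hinc
  set g := Function.invFun fun s => β s + ζ s with hg
  have hr : ∀ t, β (g t) + ζ (g t) = t := Function.rightInverse_invFun hbij.2
  have hgm : Monotone g := fun s t hst => by
    rw [← hinc.le_iff_le]
    simpa only [hr] using hst
  have hmu : ∀ t, mu β ζ t = ζ (g t) := fun t => rfl
  refine ⟨fun s t hst => hζm (hgm hst), fun s t hst => ?_, ?_, ?_⟩
  · rw [hmu, hmu]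
    have := hβm (hgm hst)
    linarith [hr s, hr t]
  · have : g 0 = 0 := hinc.injective (by simp [hr, hβ0, hζ0])
    rw [hmu, this, hζ0]
  · obtain ⟨M₀, hM₀, M₁, hM₁, h1⟩ := hζg
    obtain ⟨K₀, hK₀, K₁, hK₁, h2⟩ := hβg
    refine ⟨K₀ / M₀ + 1, K₀ * M₁ / M₀ + K₁, by positivity, by positivity, fun t => ?_⟩
    have h3 : |g t| ≤ (|ζ (g t)| + M₁) / M₀ := by
      rw [le_div_iff₀ hM₀]; linarith [h1 (g t)]
    have h4 := mul_le_mul_of_nonneg_left h3 hK₀.le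
    rw [hmu]
    calc |t| = |β (g t) + ζ (g t)| := by rw [hr]
      _ ≤ |β (g t)| + |ζ (g t)| := abs_add_le _ _
      _ ≤ K₀ * ((|ζ (g t)| + M₁) / M₀) + K₁ + |ζ (g t)| := by linarith [h2 (g t)]
      _ = _ := by field_simp; ring

/-- `∫₀ˢ √(m')`. -/
def sqrtPrim (m : ℝ → ℝ) (s : ℝ) : ℝ := ∫ r in (0 : ℝ)..s, Real.sqrt (deriv m r)

namespace Admissible

variable {m : ℝ → ℝ}

theorem abs_sub_le (hm : Admissible m) (s t : ℝ) : |m s - m t| ≤ |s - t| := by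
  rcases le_total s t with h | h
  · rw [abs_sub_comm, abs_sub_comm s, abs_of_nonneg (sub_nonneg.2 (hm.mono h)),
      abs_of_nonneg (sub_nonneg.2 h)]
    exact hm.sub_le s t h
  · rw [abs_of_nonneg (sub_nonneg.2 (hm.mono h)), abs_of_nonneg (sub_nonneg.2 h)]
    exact hm.sub_le t s h

theorem abs_le (hm : Admissible m) (t : ℝ) : |m t| ≤ |t| := by
  simpa [hm.zero] using hm.abs_sub_le t 0

theorem lipschitz (hm : Admissible m) : LipschitzWith 1 m :=
  LipschitzWith.of_dist_le_mul fun s t => by simpa [Real.dist_eq] using hm.abs_sub_le s t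

theorem continuous (hm : Admissible m) : Continuous m := hm.lipschitz.continuous

theorem mul_nonneg_rho (hm : Admissible m) (s t : ℝ) :
    0 ≤ ((s - m s) - (t - m t)) * (s - t) := by
  rcases le_total s t with h | h
  · exact mul_nonneg_of_nonpos_of_nonpos (by linarith [hm.sub_le s t h]) (sub_nonpos.2 h)
  · exact mul_nonneg (by linarith [hm.sub_le t s h]) (sub_nonneg.2 h)

/-- Equivalently `(m s - m t)² ≤ (s - t)(m s - m t)`, the form used to identify weak limits. -/
theorem mul_nonneg_rho_mu (hm : Admissible m) (s t : ℝ) :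
    0 ≤ ((s - m s) - (t - m t)) * (m s - m t) := by
  rcases le_total s t with h | h
  · exact mul_nonneg_of_nonpos_of_nonpos (by linarith [hm.sub_le s t h])
      (sub_nonpos.2 (hm.mono h))
  · exact mul_nonneg (by linarith [hm.sub_le t s h]) (sub_nonneg.2 (hm.mono h))

theorem deriv_nonneg (hm : Admissible m) (s : ℝ) : 0 ≤ deriv m s := hm.mono.deriv_nonneg

theorem deriv_le_one (hm : Admissible m) (s : ℝ) : deriv m s ≤ 1 :=
  (le_abs_self _).trans (by simpa using norm_deriv_le_of_lipschitz hm.lipschitz (x₀ := s))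

theorem norm_deriv_le_one (hm : Admissible m) (s : ℝ) : ‖deriv m s‖ ≤ 1 := by
  rw [Real.norm_of_nonneg (hm.deriv_nonneg s)]
  exact hm.deriv_le_one s

theorem norm_sqrt_deriv_le_one (hm : Admissible m) (s : ℝ) : ‖Real.sqrt (deriv m s)‖ ≤ 1 := by
  rw [Real.norm_of_nonneg (Real.sqrt_nonneg _)]
  exact Real.sqrt_le_one.2 (hm.deriv_le_one s)

theorem measurable_sqrt_deriv (m : ℝ → ℝ) : Measurable fun s => Real.sqrt (deriv m s) :=
  (measurable_deriv m).sqrt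

theorem integral_deriv (hm : Admissible m) (s t : ℝ) : ∫ r in s..t, deriv m r = m t - m s :=
  (hm.lipschitz.lipschitzOnWith.absolutelyContinuousOnInterval).integral_deriv_eq_sub

theorem integral_deriv_zero (hm : Admissible m) (t : ℝ) : ∫ r in (0 : ℝ)..t, deriv m r = m t := by
  rw [hm.integral_deriv, hm.zero, sub_zero]

theorem intervalIntegrable_deriv (hm : Admissible m) (s t : ℝ) :
    IntervalIntegrable (deriv m) volume s t :=
  intervalIntegrable_of_bounded (measurable_deriv m) hm.norm_deriv_le_one s t

theorem intervalIntegrable_sqrt_deriv (hm : Admissible m) (s t : ℝ) :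
    IntervalIntegrable (fun r => Real.sqrt (deriv m r)) volume s t :=
  intervalIntegrable_of_bounded (measurable_sqrt_deriv m) hm.norm_sqrt_deriv_le_one s t

theorem sqrtPrim_sub (hm : Admissible m) (s t : ℝ) :
    sqrtPrim m t - sqrtPrim m s = ∫ r in s..t, Real.sqrt (deriv m r) :=
  intervalIntegral.integral_interval_sub_left (hm.intervalIntegrable_sqrt_deriv _ _)
    (hm.intervalIntegrable_sqrt_deriv _ _)

/-- From `0 ≤ m' ≤ 1` follows `m' ≤ √m'`. Hence `ν` dominates `μ` and inherits its growth. -/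
theorem sub_le_sqrtPrim_sub (hm : Admissible m) {s t : ℝ} (h : s ≤ t) :
    m t - m s ≤ sqrtPrim m t - sqrtPrim m s := by
  rw [hm.sqrtPrim_sub, ← hm.integral_deriv]
  refine intervalIntegral.integral_mono_on h (hm.intervalIntegrable_deriv _ _)
    (hm.intervalIntegrable_sqrt_deriv _ _) fun r _ => ?_
  exact Real.le_sqrt_of_sq_le (by nlinarith [hm.deriv_nonneg r, hm.deriv_le_one r])

theorem abs_le_abs_sqrtPrim (hm : Admissible m) (t : ℝ) : |m t| ≤ |sqrtPrim m t| := by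
  have h0 : sqrtPrim m 0 = 0 := intervalIntegral.integral_same
  rcases le_total 0 t with h | h
  · have h1 := hm.sub_le_sqrtPrim_sub h
    have h2 := hm.mono h
    rw [hm.zero] at h1 h2
    rw [abs_of_nonneg h2]
    exact le_trans (by linarith) (le_abs_self _)
  · have h1 := hm.sub_le_sqrtPrim_sub h
    have h2 := hm.mono h
    rw [hm.zero] at h1 h2
    rw [abs_of_nonpos h2]
    exact le_trans (by linarith) (neg_le_abs _)

/-- Cauchy–Schwarz for `√m'` and `1` on `[s, t]`, obtained by integrating `(√m' - c)² ≥ 0` with `c`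
the mean of `√m'`. -/
theorem sq_sqrtPrim_sub_le_of_lt (hm : Admissible m) {s t : ℝ} (h : s < t) :
    (sqrtPrim m t - sqrtPrim m s) ^ 2 ≤ (t - s) * (m t - m s) := by
  rw [hm.sqrtPrim_sub, ← hm.integral_deriv]
  set I := ∫ r in s..t, Real.sqrt (deriv m r)
  set J := ∫ r in s..t, deriv m r
  have hts : 0 < t - s := sub_pos.2 h
  set c := I / (t - s) with hc
  have h1 : 0 ≤ ∫ r in s..t, (deriv m r - (2 * c) * Real.sqrt (deriv m r) + c ^ 2) := by
    refine intervalIntegral.integral_nonneg h.le fun r _ => ?_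
    have := Real.sq_sqrt (hm.deriv_nonneg r)
    nlinarith [sq_nonneg (Real.sqrt (deriv m r) - c)]
  rw [intervalIntegral.integral_add ((hm.intervalIntegrable_deriv _ _).sub
      ((hm.intervalIntegrable_sqrt_deriv _ _).const_mul _)) intervalIntegrable_const,
    intervalIntegral.integral_sub (hm.intervalIntegrable_deriv _ _)
      ((hm.intervalIntegrable_sqrt_deriv _ _).const_mul _),
    intervalIntegral.integral_const_mul, intervalIntegral.integral_const, smul_eq_mul] at h1
  have h2 : c * (t - s) = I := div_mul_cancel₀ _ hts.ne'
  have h3 : 0 ≤ J - 2 * c * I + (t - s) * c ^ 2 := h1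
  have h4 : 0 ≤ (t - s) * (J - 2 * c * I + (t - s) * c ^ 2) := mul_nonneg hts.le h3
  have h5 : (t - s) * (J - 2 * c * I + (t - s) * c ^ 2) =
      (t - s) * J - 2 * (c * (t - s)) * I + (c * (t - s)) ^ 2 := by ring
  rw [h5, h2] at h4
  linarith

theorem sq_sqrtPrim_sub_le (hm : Admissible m) (s t : ℝ) :
    (sqrtPrim m t - sqrtPrim m s) ^ 2 ≤ (t - s) * (m t - m s) := by
  rcases lt_trichotomy s t with h | rfl | h
  · exact hm.sq_sqrtPrim_sub_le_of_lt h
  · simp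
  · have := hm.sq_sqrtPrim_sub_le_of_lt h
    nlinarith

end Admissible

end DegenElliptic

/-! ### The diffusion operator -/

namespace DegenElliptic

/-- Bounds on a symmetric matrix from bounds on its eigenvalues. -/
theorem matrix_bounds {d : ℕ} {A : Matrix (Fin d) (Fin d) ℝ} (hA : A.IsSymm) {l L : ℝ} (hl : 0 < l)
    (hlL : ∀ a : ℝ, Module.End.HasEigenvalue (Matrix.toLin' A) a → a ∈ Set.Icc l L) (v : Space d) :
    ‖Matrix.toEuclideanLin A v‖ ≤ |L| * ‖v‖ ∧
      l * ‖v‖ ^ 2 ≤ inner ℝ (Matrix.toEuclideanLin A v) v := by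
  have hH : A.IsHermitian := by
    rw [Matrix.IsHermitian, Matrix.conjTranspose_eq_transpose_of_trivial]
    exact hA
  have hT : (Matrix.toEuclideanLin A).IsSymmetric := Matrix.isSymmetric_toEuclideanLin_iff.2 hH
  have hn : Module.finrank ℝ (Space d) = d := finrank_euclideanSpace_fin
  -- Both bounds are read off coordinatewise in an orthonormal eigenbasis, where `0 < l ≤ eᵢ ≤ L`.
  let b := hT.eigenvectorBasis hn
  let e := hT.eigenvalues hn
  have he : ∀ i, e i ∈ Set.Icc l L := by
    intro i
    refine hlL _ (Module.End.hasEigenvalue_of_hasEigenvector (x := (b i).ofLp)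
      ⟨Module.End.mem_eigenspace_iff.2 ?_, fun h => ?_⟩)
    · have := hT.apply_eigenvectorBasis hn i
      exact congrArg WithLp.ofLp this
    · exact b.toBasis.ne_zero i (by simpa using congrArg (WithLp.toLp 2) h)
  have hc : ∀ i, inner ℝ (b i) (Matrix.toEuclideanLin A v) = e i * inner ℝ (b i) v := by
    intro i
    rw [← hT, hT.apply_eigenvectorBasis hn i, inner_smul_left]
    rfl
  constructor
  · have h1 : ‖Matrix.toEuclideanLin A v‖ ^ 2 ≤ (|L| * ‖v‖) ^ 2 := by
      rw [mul_pow, ← b.sum_sq_norm_inner_right, ← b.sum_sq_norm_inner_right v, Finset.mul_sum]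
      refine Finset.sum_le_sum fun i _ => ?_
      rw [hc, norm_mul, mul_pow]
      refine mul_le_mul_of_nonneg_right ?_ (by positivity)
      rw [Real.norm_eq_abs, sq_abs, sq_abs]
      nlinarith [(he i).1, (he i).2]
    exact le_of_sq_le_sq h1 (by positivity)
  · rw [← b.sum_inner_mul_inner, ← b.sum_sq_norm_inner_right v, Finset.mul_sum]
    refine Finset.sum_le_sum fun i _ => ?_
    rw [real_inner_comm (b i) (Matrix.toEuclideanLin A v), hc, Real.norm_eq_abs, sq_abs]
    nlinarith [(he i).1, sq_nonneg (inner ℝ (b i) v)]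

variable {d : ℕ} {Ω : Set (Space d)}

/-- Multiplication by the diffusion matrix is a coercive operator of `L²(Ω)^d`. -/
theorem exists_diffusion_operator {Λ : Space d → Matrix (Fin d) (Fin d) ℝ}
    (hΛm : ∀ i j, AEMeasurable (fun x => Λ x i j) (volume.restrict Ω))
    (hΛ : ∃ lmin lmax : ℝ, 0 < lmin ∧ lmin ≤ lmax ∧ ∀ᵐ x ∂(volume.restrict Ω),
      (Λ x).IsSymm ∧
        ∀ l : ℝ, Module.End.HasEigenvalue (Matrix.toLin' (Λ x)) l → l ∈ Set.Icc lmin lmax) :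
    ∃ A : L2Vec Ω →L[ℝ] L2Vec Ω, ∃ l : ℝ, 0 < l ∧
      (∀ F, ∀ᵐ x ∂(volume.restrict Ω), A F x = Matrix.toEuclideanLin (Λ x) (F x)) ∧
      ∀ F, l * ‖F‖ ^ 2 ≤ inner ℝ (A F) F := by
  obtain ⟨l, L, hl, -, hae⟩ := hΛ
  have hb : ∀ᵐ x ∂(volume.restrict Ω), ∀ v : Space d,
      ‖Matrix.toEuclideanLin (Λ x) v‖ ≤ |L| * ‖v‖ ∧
        l * ‖v‖ ^ 2 ≤ inner ℝ (Matrix.toEuclideanLin (Λ x) v) v := by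
    filter_upwards [hae] with x hx v
    exact matrix_bounds hx.1 hl hx.2 v
  have hmeas : ∀ F : L2Vec Ω, AEStronglyMeasurable (fun x => Matrix.toEuclideanLin (Λ x) (F x))
      (volume.restrict Ω) := by
    intro F
    refine (PiLp.continuous_toLp 2 (fun _ : Fin d => ℝ)).comp_aestronglyMeasurable
      (f := fun x => (Λ x).mulVec (F x).ofLp) ?_
    refine (aemeasurable_pi_lambda _ fun i => ?_).aestronglyMeasurable
    refine Finset.aemeasurable_fun_sum Finset.univ (f := fun j x => Λ x i j * F x j) fun j _ =>
      (hΛm i j).mul ?_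
    exact ((EuclideanSpace.proj (𝕜 := ℝ) j).continuous.comp_aestronglyMeasurable
      (Lp.aestronglyMeasurable F)).aemeasurable
  have hmem : ∀ F : L2Vec Ω, MemLp (fun x => Matrix.toEuclideanLin (Λ x) (F x)) 2
      (volume.restrict Ω) := fun F =>
    (Lp.memLp F).of_le_mul (hmeas F) (by filter_upwards [hb] with x hx using (hx _).1)
  let A₀ : L2Vec Ω →ₗ[ℝ] L2Vec Ω :=
    { toFun := fun F => (hmem F).toLp _
      map_add' := fun F G => Lp.ext (by
        filter_upwards [(hmem (F + G)).coeFn_toLp, (hmem F).coeFn_toLp, (hmem G).coeFn_toLp,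
          Lp.coeFn_add F G, Lp.coeFn_add ((hmem F).toLp _) ((hmem G).toLp _)] with x e1 e2 e3 e4 e5
        rw [e1, e5, Pi.add_apply, e2, e3, e4, Pi.add_apply, map_add])
      map_smul' := fun c F => Lp.ext (by
        filter_upwards [(hmem (c • F)).coeFn_toLp, (hmem F).coeFn_toLp,
          Lp.coeFn_smul c F, Lp.coeFn_smul c ((hmem F).toLp _)] with x e1 e2 e4 e5
        rw [e1, RingHom.id_apply, e5, Pi.smul_apply, e2, e4, Pi.smul_apply, map_smul]) }
  have hA₀ : ∀ F, ∀ᵐ x ∂(volume.restrict Ω), A₀ F x = Matrix.toEuclideanLin (Λ x) (F x) :=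
    fun F => (hmem F).coeFn_toLp
  refine ⟨A₀.mkContinuous |L| fun F => ?_, l, hl, hA₀, fun F => ?_⟩
  · refine Lp.norm_le_mul_norm_of_ae_le_mul ?_
    filter_upwards [hA₀ F, hb] with x e1 e2
    rw [e1]
    exact (e2 _).1
  · change l * ‖F‖ ^ 2 ≤ inner ℝ (A₀ F) F
    rw [norm_sq_Lp_two, L2.inner_def, ← integral_const_mul]
    refine integral_mono_ae ((Lp.memLp F).integrable_norm_pow two_ne_zero |>.const_mul _)
      (L2.integrable_inner _ _) ?_
    filter_upwards [hA₀ F, hb] with x e1 e2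
    simp only [e1]
    exact (e2 _).2

end DegenElliptic

/-! ### Compositions in `L²` and `H¹₀`, and solvability of the scheme -/

namespace DegenElliptic

variable {d : ℕ} {Ω : Set (Space d)}

section Composition

variable {m : ℝ → ℝ} {w w' u u' n n' : L2 Ω}

theorem inner_L2_nonneg {u v : L2 Ω} (h : ∀ᵐ x ∂(volume.restrict Ω), 0 ≤ u x * v x) :
    0 ≤ inner ℝ u v := by
  rw [inner_L2_eq]
  exact integral_nonneg_of_ae h

theorem exists_isComp (w : L2 Ω) {g : ℝ → ℝ} (hg : Continuous g) (hb : ∀ s, |g s| ≤ |s|) :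
    ∃ u : L2 Ω, IsComp Ω g w u := by
  have hm : MemLp (fun x => g (w x)) 2 (volume.restrict Ω) :=
    (Lp.memLp w).of_le (hg.comp_aestronglyMeasurable (Lp.aestronglyMeasurable w))
      (Eventually.of_forall fun x => hb _)
  exact ⟨hm.toLp _, hm.coeFn_toLp⟩

theorem IsComp.eq {g : ℝ → ℝ} (h : IsComp Ω g w u) (h' : IsComp Ω g w u') : u = u' :=
  Lp.ext (by filter_upwards [h, h'] with x e e'; rw [e, e'])

/-- The integral of `mul_nonneg_rho_mu`. It serves both uniqueness and the identification of weak
limits. -/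
theorem IsComp.norm_sq_sub_le (hm : Admissible m) (h : IsComp Ω m w u) (h' : IsComp Ω m w' u') :
    ‖u - u'‖ ^ 2 ≤ inner ℝ (u - u') (w - w') := by
  rw [← sub_nonneg, ← real_inner_self_eq_norm_sq, ← inner_sub_right]
  refine inner_L2_nonneg ?_
  filter_upwards [h, h', Lp.coeFn_sub u u', Lp.coeFn_sub w w', Lp.coeFn_sub (w - w') (u - u')]
    with x e1 e2 e3 e4 e5
  rw [e5, Pi.sub_apply, e3, e4, Pi.sub_apply, Pi.sub_apply, e1, e2]
  have := hm.mul_nonneg_rho_mu (w x) (w' x)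
  linarith

theorem IsComp.inner_rho_nonneg (hm : Admissible m) (h : IsComp Ω m w u)
    (h' : IsComp Ω m w' u') : 0 ≤ inner ℝ ((w - u) - (w' - u')) (w - w') := by
  refine inner_L2_nonneg ?_
  filter_upwards [h, h', Lp.coeFn_sub w u, Lp.coeFn_sub w' u', Lp.coeFn_sub w w',
    Lp.coeFn_sub (w - u) (w' - u')] with x e1 e2 e3 e4 e5 e6
  rw [e6, Pi.sub_apply, e3, e4, e5, Pi.sub_apply, Pi.sub_apply, Pi.sub_apply, e1, e2]
  exact hm.mul_nonneg_rho _ _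

/-- The integrated Cauchy–Schwarz bound. If `w` converges weakly and `μ(w)` strongly, its right side
tends to zero, which forces strong convergence of `ν(w)`. -/
theorem IsComp.norm_sq_sqrtPrim_sub_le (hm : Admissible m) (h : IsComp Ω m w u)
    (h' : IsComp Ω m w' u') (hn : IsComp Ω (sqrtPrim m) w n) (hn' : IsComp Ω (sqrtPrim m) w' n') :
    ‖n - n'‖ ^ 2 ≤ inner ℝ (w - w') (u - u') := by
  rw [norm_sq_Lp_two, inner_L2_eq]
  refine integral_mono_ae ((Lp.memLp (n - n')).integrable_norm_pow two_ne_zero)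
    ((Lp.memLp (w - w')).integrable_mul (Lp.memLp (u - u'))) ?_
  filter_upwards [h, h', hn, hn', Lp.coeFn_sub u u', Lp.coeFn_sub w w', Lp.coeFn_sub n n']
    with x e1 e2 e3 e4 e5 e6 e7
  rw [e5, e6, e7, Pi.sub_apply, Pi.sub_apply, Pi.sub_apply, e1, e2, e3, e4, Real.norm_eq_abs,
    sq_abs]
  exact hm.sq_sqrtPrim_sub_le _ _

theorem IsComp.norm_le (hm : Admissible m) (h : IsComp Ω m w u) : ‖u‖ ≤ ‖w‖ := by
  refine Lp.norm_le_norm_of_ae_le ?_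
  filter_upwards [h] with x e
  rw [e]
  exact hm.abs_le _

theorem Admissible.abs_sqrtPrim_le {m : ℝ → ℝ} (hm : Admissible m) (s : ℝ) :
    |sqrtPrim m s| ≤ |s| := by
  have h := norm_intervalIntegral_le hm.norm_sqrt_deriv_le_one s
  rwa [one_mul] at h

theorem Admissible.continuous_sqrtPrim {m : ℝ → ℝ} (hm : Admissible m) :
    Continuous (sqrtPrim m) :=
  intervalIntegral.continuous_primitive hm.intervalIntegrable_sqrt_deriv 0

theorem IsComp.norm_sqrtPrim_le (hm : Admissible m) (h : IsComp Ω (sqrtPrim m) w n) :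
    ‖n‖ ≤ ‖w‖ := by
  refine Lp.norm_le_norm_of_ae_le ?_
  filter_upwards [h] with x e
  rw [e]
  exact hm.abs_sqrtPrim_le _

/-- `ν(w)` controls `w`. -/
theorem exists_norm_le_sqrtPrim [IsFiniteMeasure (volume.restrict Ω)] (hm : Admissible m) :
    ∃ a b : ℝ, 0 ≤ a ∧ 0 ≤ b ∧ ∀ w n : L2 Ω, IsComp Ω (sqrtPrim m) w n → ‖w‖ ≤ a * ‖n‖ + b := by
  obtain ⟨a, b, ha, hb, hab⟩ := hm.growth
  let c : L2 Ω := Lp.const 2 (volume.restrict Ω) b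
  refine ⟨a, ‖c‖, ha, norm_nonneg _, fun w n hn => ?_⟩
  have h1 : ‖w‖ ≤ ‖a • |n| + c‖ := by
    refine Lp.norm_le_norm_of_ae_le ?_
    filter_upwards [hn, Lp.coeFn_add (a • |n|) c, Lp.coeFn_smul a |n|, Lp.coeFn_abs n,
      Lp.coeFn_const (p := 2) (μ := volume.restrict Ω) (c := b)] with x e1 e2 e3 e4 e5
    rw [e2, Pi.add_apply, e3, Pi.smul_apply, e4, e1, show c x = b from e5, smul_eq_mul,
      Real.norm_eq_abs, Real.norm_of_nonneg (by positivity)]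
    refine (hab _).trans ?_
    linarith [mul_le_mul_of_nonneg_left (hm.abs_le_abs_sqrtPrim (w x)) ha]
  refine h1.trans ((norm_add_le _ _).trans ?_)
  rw [norm_smul, norm_abs_eq_norm, Real.norm_of_nonneg ha]

end Composition

section ChainRule

variable {m : ℝ → ℝ} (hm : Admissible m)

/-- `μ(w)` as an element of `H¹₀(Ω)`. -/
def compMu (hm : Admissible m) (w : H10 Ω) : H10 Ω :=
  (primComp w (measurable_deriv m) hm.norm_deriv_le_one).exists_comp.choose

/-- `ν(w)` as an element of `H¹₀(Ω)`. -/
def compNu (hm : Admissible m) (w : H10 Ω) : H10 Ω :=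
  (primComp w (Admissible.measurable_sqrt_deriv m) hm.norm_sqrt_deriv_le_one).exists_comp.choose

theorem isComp_compMu (w : H10 Ω) : IsComp Ω m (toL2 w) (toL2 (compMu hm w)) := by
  filter_upwards [(primComp w (measurable_deriv m) hm.norm_deriv_le_one).exists_comp.choose_spec.1]
    with x e
  rw [← hm.integral_deriv_zero]
  exact e

theorem grad_compMu (w : H10 Ω) : ∀ᵐ x ∂(volume.restrict Ω),
    grad (compMu hm w) x = deriv m (toL2 w x) • grad w x :=
  (primComp w (measurable_deriv m) hm.norm_deriv_le_one).exists_comp.choose_spec.2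

theorem isComp_compNu (w : H10 Ω) : IsComp Ω (sqrtPrim m) (toL2 w) (toL2 (compNu hm w)) :=
  (primComp w (Admissible.measurable_sqrt_deriv m)
    hm.norm_sqrt_deriv_le_one).exists_comp.choose_spec.1

theorem grad_compNu (w : H10 Ω) : ∀ᵐ x ∂(volume.restrict Ω),
    grad (compNu hm w) x = Real.sqrt (deriv m (toL2 w x)) • grad w x :=
  (primComp w (Admissible.measurable_sqrt_deriv m)
    hm.norm_sqrt_deriv_le_one).exists_comp.choose_spec.2

theorem norm_grad_compMu_le (w : H10 Ω) : ‖grad (compMu hm w)‖ ≤ ‖grad (compNu hm w)‖ := by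
  refine Lp.norm_le_norm_of_ae_le ?_
  filter_upwards [grad_compMu hm w, grad_compNu hm w] with x e1 e2
  rw [e1, e2, norm_smul, norm_smul, Real.norm_of_nonneg (hm.deriv_nonneg _),
    Real.norm_of_nonneg (Real.sqrt_nonneg _)]
  refine mul_le_mul_of_nonneg_right ?_ (norm_nonneg _)
  exact Real.le_sqrt_of_sq_le (by nlinarith [hm.deriv_nonneg (toL2 w x), hm.deriv_le_one (toL2 w x)])

theorem norm_grad_compNu_le (w : H10 Ω) : ‖grad (compNu hm w)‖ ≤ ‖grad w‖ := by
  refine Lp.norm_le_norm_of_ae_le ?_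
  filter_upwards [grad_compNu hm w] with x e1
  rw [e1, norm_smul]
  exact mul_le_of_le_one_left (norm_nonneg _) (hm.norm_sqrt_deriv_le_one _)

theorem norm_le_add (U : H10 Ω) : ‖U‖ ≤ ‖toL2 U‖ + ‖grad U‖ := by
  have := norm_sq_eq U
  exact le_of_sq_le_sq (by nlinarith [norm_nonneg (toL2 U), norm_nonneg (grad U)]) (by positivity)

theorem norm_compMu_le (w : H10 Ω) : ‖compMu hm w‖ ≤ ‖w‖ + ‖w‖ :=
  (norm_le_add _).trans (add_le_add (((isComp_compMu hm w).norm_le hm).trans (norm_toL2_le w))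
    ((norm_grad_compMu_le hm w).trans ((norm_grad_compNu_le hm w).trans (norm_grad_le w))))

/-- The energy identity for the diffusion term. -/
theorem inner_diffusion_compMu {Λ : Space d → Matrix (Fin d) (Fin d) ℝ}
    {A : L2Vec Ω →L[ℝ] L2Vec Ω}
    (hA : ∀ F, ∀ᵐ x ∂(volume.restrict Ω), A F x = Matrix.toEuclideanLin (Λ x) (F x)) (w : H10 Ω) :
    inner ℝ (A (grad (compMu hm w))) (grad w) =
      inner ℝ (A (grad (compNu hm w))) (grad (compNu hm w)) := by
  rw [L2.inner_def, L2.inner_def]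
  refine integral_congr_ae ?_
  filter_upwards [grad_compMu hm w, grad_compNu hm w, hA (grad (compMu hm w)),
    hA (grad (compNu hm w))] with x e1 e2 e3 e4
  -- The factor `μ'(w)` is shared as `√μ'(w) · √μ'(w)` between the two slots, which makes `ν(w)` the
  -- energy variable.
  rw [e3, e4, e1, e2, map_smul, map_smul, real_inner_smul_left, real_inner_smul_left,
    real_inner_smul_right, ← mul_assoc, Real.mul_self_sqrt (hm.deriv_nonneg _)]

/-- `w ↦ μ(w)` is continuous from `H¹₀(Ω)` to `H¹₀(Ω)` with its weak topology. -/
theorem continuous_clm_compMu [IsFiniteMeasure (volume.restrict Ω)] (hΩ : IsOpen Ω)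
    (ℓ : H10 Ω →L[ℝ] ℝ) : Continuous fun w : H10 Ω => ℓ (compMu hm w) := by
  refine continuous_iff_seqContinuous.2 fun w w' hw => ?_
  obtain ⟨C, hC⟩ := hw.norm.bddAbove_range
  have hC' : ∀ n, ‖compMu hm (w n)‖ ≤ C + C := fun n => (norm_compMu_le hm (w n)).trans
    (add_le_add (hC ⟨n, rfl⟩) (hC ⟨n, rfl⟩))
  -- Since `μ'` may jump, the gradients are only shown to converge weakly. The `H¹` bound together
  -- with strong `L²` convergence, from the Lipschitz property, is enough.
  refine (tendstoWeakly_of_toL2 hΩ hC' (tendstoWeakly_of_tendsto ?_)).clm ℓ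
  have h1 : Tendsto (fun n => toL2 (w n)) atTop (𝓝 (toL2 w')) :=
    ((toL2L Ω).continuous.tendsto _).comp hw
  rw [tendsto_iff_norm_sub_tendsto_zero] at h1 ⊢
  refine squeeze_zero (fun n => norm_nonneg _) (fun n => ?_) h1
  have h2 := (isComp_compMu hm (w n)).norm_sq_sub_le hm (isComp_compMu hm w')
  have h3 := h2.trans (real_inner_le_norm _ _)
  by_contra! h4
  nlinarith [norm_nonneg (toL2 (w n) - toL2 w')]

end ChainRule

section FiniteDimensional

variable {X Y : Type*} [NormedAddCommGroup X] [NormedSpace ℝ X] [NormedAddCommGroup Y]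
  [InnerProductSpace ℝ Y]

/-- A finite-dimensional subspace, parametrized isometrically for the norm of a larger Hilbert
space. -/
theorem exists_parametrization (T : X →ₗ[ℝ] Y) (hT : Function.Injective T) (V : Submodule ℝ X)
    [FiniteDimensional ℝ V] :
    ∃ (k : ℕ) (W : EuclideanSpace ℝ (Fin k) →L[ℝ] X), (∀ x, W x ∈ V) ∧
      (∀ v ∈ V, ∃ x, W x = v) ∧ ∀ x, ‖T (W x)‖ = ‖x‖ := by
  let E := Submodule.equivMapOfInjective T hT V
  let b := stdOrthonormalBasis ℝ (V.map T)
  let W₀ : EuclideanSpace ℝ (Fin (Module.finrank ℝ (V.map T))) →ₗ[ℝ] X :=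
    V.subtype ∘ₗ (E.symm : V.map T →ₗ[ℝ] V) ∘ₗ
      (b.repr.symm.toLinearEquiv : EuclideanSpace ℝ _ →ₗ[ℝ] V.map T)
  have hW : ∀ x, T (W₀ x) = (b.repr.symm x : Y) := by
    intro x
    have h1 : (E (E.symm (b.repr.symm x)) : Y) = T (E.symm (b.repr.symm x)) :=
      Submodule.coe_equivMapOfInjective_apply T hT V _
    rw [LinearEquiv.apply_symm_apply] at h1
    exact h1.symm
  refine ⟨_, LinearMap.toContinuousLinearMap W₀, fun x => (E.symm (b.repr.symm x)).2,
    fun v hv => ⟨b.repr (E ⟨v, hv⟩), hT ?_⟩, fun x => ?_⟩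
  · change T (W₀ _) = _
    rw [hW, LinearIsometryEquiv.symm_apply_apply]
    exact Submodule.coe_equivMapOfInjective_apply T hT V _
  · change ‖T (W₀ x)‖ = _
    rw [hW]
    exact b.repr.symm.norm_map x

/-- A coercive continuous nonlinear problem on a finite-dimensional space has a solution. -/
theorem exists_zero_on_subspace (T : X →L[ℝ] Y) (hT : Function.Injective T) (V : Submodule ℝ X)
    [FiniteDimensional ℝ V] (r : X → X →L[ℝ] ℝ) (hr : ∀ v, Continuous fun w => r w v) {R : ℝ}
    (hR : 0 < R) (hpos : ∀ w, R ≤ ‖T w‖ → 0 < r w w) : ∃ w ∈ V, ∀ v ∈ V, r w v = 0 := by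
  -- The coordinates are orthonormal for the pulled-back norm `‖T ·‖`, the one in which coercivity
  -- is assumed. For the scheme `T` is the embedding in `L²`.
  obtain ⟨k, W, hWV, hWs, hWn⟩ := exists_parametrization (T : X →ₗ[ℝ] Y) hT V
  let F : EuclideanSpace ℝ (Fin k) → EuclideanSpace ℝ (Fin k) := fun x =>
    (InnerProductSpace.toDual ℝ _).symm ((r (W x)).comp W)
  have hFi : ∀ x y, inner ℝ (F x) y = r (W x) (W y) := fun x y => by
    simp only [F]
    rw [InnerProductSpace.toDual_symm_apply]
    rfl
  have hF : Continuous F := by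
    refine (PiLp.continuous_toLp 2 (fun _ : Fin k => ℝ)).comp
      (f := fun x => (F x).ofLp) (continuous_pi fun i => ?_)
    have h2 := (hr (W (EuclideanSpace.single i 1))).comp W.continuous
    refine h2.congr fun x => ?_
    have h1 : inner ℝ (F x) (EuclideanSpace.single i (1 : ℝ)) = F x i :=
      (EuclideanSpace.inner_single_right i 1 _).trans (one_mul _)
    rw [← h1, hFi]
    rfl
  obtain ⟨x, hx⟩ := exists_zero_of_inner_pos hF hR fun x hx => by
    rw [hFi]
    exact hpos _ (by rw [← hWn] at hx; exact hx)
  refine ⟨W x, hWV x, fun v hv => ?_⟩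
  obtain ⟨y, rfl⟩ := hWs v hv
  rw [← hFi, hx, inner_zero_left]

end FiniteDimensional

section Scheme

variable {m : ℝ → ℝ} (hm : Admissible m) {A : L2Vec Ω →L[ℝ] L2Vec Ω} {l C : ℝ}

/-- The residual of the equation for `w`, `M = μ(w)`. -/
def residual (A : L2Vec Ω →L[ℝ] L2Vec Ω) (f w : L2 Ω) (M : H10 Ω) : H10 Ω →L[ℝ] ℝ :=
  (innerSL ℝ (w - toL2 M)).comp (toL2L Ω) + (innerSL ℝ (A (grad M))).comp (gradL Ω) -
    (innerSL ℝ f).comp (toL2L Ω)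

theorem residual_apply (f w : L2 Ω) (M v : H10 Ω) : residual A f w M v =
    inner ℝ (w - toL2 M) (toL2 v) + inner ℝ (A (grad M)) (grad v) - inner ℝ f (toL2 v) := rfl

theorem residual_apply_sub (f : L2 Ω) (w M v : H10 Ω) : residual A f (toL2 w) M v =
    inner ℝ (toL2 w) (toL2 v) - inner ℝ (toL2 M) (toL2 v) + inner ℝ (A (grad M)) (grad v) -
      inner ℝ f (toL2 v) :=
  (residual_apply f (toL2 w) M v).trans
    (congrArg (fun t => t + _ - _) (inner_sub_left (𝕜 := ℝ) (toL2 w) (toL2 M) (toL2 v)))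

/-- Coercivity of the equation. -/
theorem exists_residual_pos [IsFiniteMeasure (volume.restrict Ω)] (hC0 : 0 < C)
    (hC : ∀ U : H10 Ω, ‖toL2 U‖ ≤ C * ‖grad U‖) (hl : 0 < l)
    (hAl : ∀ F, l * ‖F‖ ^ 2 ≤ inner ℝ (A F) F)
    (hA : ∀ w : H10 Ω, inner ℝ (A (grad (compMu hm w))) (grad w) =
      inner ℝ (A (grad (compNu hm w))) (grad (compNu hm w))) (f : L2 Ω) :
    ∃ R : ℝ, 0 < R ∧ ∀ w : H10 Ω, R ≤ ‖toL2 w‖ → 0 < residual A f (toL2 w) (compMu hm w) w := by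
  obtain ⟨a, b, ha, hb, hab⟩ := exists_norm_le_sqrtPrim (Ω := Ω) hm
  -- The product `a * C` combines growth and Poincaré constants. The added 1 ensures `k > 0` even if
  -- `a = 0`.
  set k := a * C + 1 with hk
  have hk0 : 0 < k := by positivity
  -- Beyond `2b`, the bound `x ≤ ky + b` gives `x ≤ 2ky`. Beyond `4k²‖f‖/l`, the diffusion `l y²`
  -- then strictly exceeds the source `‖f‖ x`.
  refine ⟨2 * b + 4 * k ^ 2 * ‖f‖ / l + 1, by positivity, fun w hw => ?_⟩
  have h1 := hab _ _ (isComp_compNu hm w)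
  set x := ‖toL2 w‖ with hx
  set y := ‖grad (compNu hm w)‖ with hy
  have hy0 : 0 ≤ y := norm_nonneg _
  have h2 : x ≤ k * y + b := by
    have := mul_le_mul_of_nonneg_left (hC (compNu hm w)) ha
    calc x ≤ a * ‖toL2 (compNu hm w)‖ + b := h1
      _ ≤ a * (C * y) + b := by linarith
      _ ≤ k * y + b := by rw [hk]; linarith
  have h0 : IsComp Ω m 0 (0 : L2 Ω) := by
    filter_upwards [Lp.coeFn_zero ℝ 2 (volume.restrict Ω)] with z e
    rw [e, Pi.zero_apply, hm.zero]
  have h3 := (isComp_compMu hm w).inner_rho_nonneg hm h0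
  simp only [sub_zero] at h3
  have h4 := hAl (grad (compNu hm w))
  have h5 : inner ℝ f (toL2 w) ≤ ‖f‖ * x := real_inner_le_norm _ _
  rw [residual_apply, hA]
  have hf0 := norm_nonneg f
  have h6 : 4 * k ^ 2 * ‖f‖ / l < x := by linarith
  rw [div_lt_iff₀ hl] at h6
  have h7 : x ≤ 2 * (k * y) := by
    have : 0 ≤ 4 * k ^ 2 * ‖f‖ / l := by positivity
    linarith
  have hx0 : 0 < x := by
    have : 0 ≤ 4 * k ^ 2 * ‖f‖ / l := by positivity
    linarith
  have h8 : x ^ 2 ≤ 4 * k ^ 2 * y ^ 2 := by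
    have := pow_le_pow_left₀ hx0.le h7 2
    linarith [this, show (2 * (k * y)) ^ 2 = 4 * k ^ 2 * y ^ 2 by ring]
  have h9 : 4 * k ^ 2 * (‖f‖ * x) < 4 * k ^ 2 * (l * y ^ 2) := by
    calc 4 * k ^ 2 * (‖f‖ * x) = (4 * k ^ 2 * ‖f‖) * x := by ring
      _ < (x * l) * x := by gcongr
      _ = l * x ^ 2 := by ring
      _ ≤ l * (4 * k ^ 2 * y ^ 2) := by gcongr
      _ = _ := by ring
  have h10 : ‖f‖ * x < l * y ^ 2 := lt_of_mul_lt_mul_left h9 (by positivity)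
  linarith

theorem continuous_clm_sub_add_sub {X : Type*} [NormedAddCommGroup X] [NormedSpace ℝ X] {g : X → X}
    (hg : ∀ ℓ : X →L[ℝ] ℝ, Continuous fun w => ℓ (g w)) (ℓ₁ ℓ₂ : X →L[ℝ] ℝ) (c : ℝ) :
    Continuous fun w => ℓ₁ w - ℓ₁ (g w) + ℓ₂ (g w) - c :=
  ((ℓ₁.continuous.sub (hg ℓ₁)).add (hg ℓ₂)).sub continuous_const

/-- For a fixed test element the residual is affine in `(w, μ(w))`, so continuity of `μ(w)` into the
weak topology suffices. -/
theorem continuous_residual [IsFiniteMeasure (volume.restrict Ω)] (hΩ : IsOpen Ω)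
    (A : L2Vec Ω →L[ℝ] L2Vec Ω) (f : L2 Ω) (v : H10 Ω) :
    Continuous fun w : H10 Ω => residual A f (toL2 w) (compMu hm w) v := by
  obtain ⟨ℓ₁, hℓ₁⟩ : ∃ ℓ : H10 Ω →L[ℝ] ℝ, ∀ w, ℓ w = inner ℝ (toL2 w) (toL2 v) :=
    ⟨(innerSL ℝ (toL2 v)).comp (toL2L Ω), fun w => real_inner_comm (toL2 w) (toL2 v)⟩
  obtain ⟨ℓ₂, hℓ₂⟩ : ∃ ℓ : H10 Ω →L[ℝ] ℝ, ∀ w, ℓ w = inner ℝ (A (grad w)) (grad v) :=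
    ⟨(innerSL ℝ (grad v)).comp (A.comp (gradL Ω)), fun w => real_inner_comm (A (grad w)) (grad v)⟩
  have h4 := continuous_clm_sub_add_sub (continuous_clm_compMu hm hΩ) ℓ₁ ℓ₂ (inner ℝ f (toL2 v))
  have h5 : (fun w : H10 Ω => residual A f (toL2 w) (compMu hm w) v) =
      fun w => ℓ₁ w - ℓ₁ (compMu hm w) + ℓ₂ (compMu hm w) - inner ℝ f (toL2 v) := by
    funext w
    refine (residual_apply_sub f w (compMu hm w) v).trans ?_
    exact congrArg₂ (fun s t => s + t - inner ℝ f (toL2 v))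
      (congrArg₂ (fun s t => s - t) (hℓ₁ w).symm (hℓ₁ (compMu hm w)).symm)
      (hℓ₂ (compMu hm w)).symm
  rw [h5]
  exact h4

/-- Existence of a solution of the scheme. -/
theorem exists_scheme [IsFiniteMeasure (volume.restrict Ω)] (hΩ : IsOpen Ω) (hC0 : 0 < C)
    (hC : ∀ U : H10 Ω, ‖toL2 U‖ ≤ C * ‖grad U‖) (hl : 0 < l)
    (hAl : ∀ F, l * ‖F‖ ^ 2 ≤ inner ℝ (A F) F)
    (hA : ∀ w : H10 Ω, inner ℝ (A (grad (compMu hm w))) (grad w) =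
      inner ℝ (A (grad (compNu hm w))) (grad (compNu hm w))) (f : L2 Ω)
    (V : Submodule ℝ (H10 Ω)) [FiniteDimensional ℝ V] :
    ∃ w ∈ V, ∀ v ∈ V, residual A f (toL2 w) (compMu hm w) v = 0 := by
  obtain ⟨R, hR, hpos⟩ := exists_residual_pos hm hC0 hC hl hAl hA f
  exact exists_zero_on_subspace (toL2L Ω) (toL2_injective hΩ) V
    (fun w => residual A f (toL2 w) (compMu hm w)) (continuous_residual hm hΩ A f) hR hpos

end Scheme

end DegenElliptic

/-! ### A priori bounds, uniqueness and passage to the limit -/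

namespace DegenElliptic

variable {d : ℕ} {Ω : Set (Space d)} {m : ℝ → ℝ} (hm : Admissible m)
  {A : L2Vec Ω →L[ℝ] L2Vec Ω} {l C : ℝ}

theorem isComp_zero (hm : Admissible m) : IsComp Ω m 0 (0 : L2 Ω) := by
  filter_upwards [Lp.coeFn_zero ℝ 2 (volume.restrict Ω)] with z e
  rw [e, Pi.zero_apply, hm.zero]

/-- Uniform bounds on the solutions of the schemes. -/
theorem exists_bound [IsFiniteMeasure (volume.restrict Ω)] (hC0 : 0 < C)
    (hC : ∀ U : H10 Ω, ‖toL2 U‖ ≤ C * ‖grad U‖) (hl : 0 < l)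
    (hAl : ∀ F, l * ‖F‖ ^ 2 ≤ inner ℝ (A F) F)
    (hA : ∀ w : H10 Ω, inner ℝ (A (grad (compMu hm w))) (grad w) =
      inner ℝ (A (grad (compNu hm w))) (grad (compNu hm w))) (f : L2 Ω) :
    ∃ B : ℝ, ∀ w : H10 Ω, residual A f (toL2 w) (compMu hm w) w = 0 →
      ‖toL2 w‖ ≤ B ∧ ‖compMu hm w‖ ≤ B ∧ ‖compNu hm w‖ ≤ B := by
  obtain ⟨R, hR, hpos⟩ := exists_residual_pos hm hC0 hC hl hAl hA f
  -- Coercivity excludes solutions with `‖w‖ ≥ R`. The energy identity then gives `l ‖∇ν(w)‖² ≤ ‖f‖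
  -- R`.
  set D := Real.sqrt (‖f‖ * R / l) with hD
  have hD0 : 0 ≤ D := Real.sqrt_nonneg _
  refine ⟨R + D, fun w hw => ?_⟩
  have h1 : ‖toL2 w‖ < R := by
    by_contra! h
    exact (hpos w h).ne' hw
  have h2 : ‖grad (compNu hm w)‖ ≤ D := by
    refine Real.le_sqrt_of_sq_le ?_
    rw [le_div_iff₀ hl]
    have h3 := (isComp_compMu hm w).inner_rho_nonneg hm (isComp_zero hm)
    simp only [sub_zero] at h3
    have h4 := hAl (grad (compNu hm w))
    have h5 : inner ℝ f (toL2 w) ≤ ‖f‖ * ‖toL2 w‖ := real_inner_le_norm _ _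
    rw [residual_apply, hA] at hw
    have h6 := mul_le_mul_of_nonneg_left h1.le (norm_nonneg f)
    linarith
  have h3 := (isComp_compMu hm w).norm_le hm
  have h4 := (isComp_compNu hm w).norm_sqrtPrim_le hm
  have h5 := norm_grad_compMu_le hm w
  have h6 := norm_le_add (compMu hm w)
  have h7 := norm_le_add (compNu hm w)
  exact ⟨by linarith, by linarith, by linarith⟩

/-- Uniqueness of the weak solution. -/
theorem weak_unique [IsFiniteMeasure (volume.restrict Ω)] (hΩ : IsOpen Ω)
    (hC : ∀ U : H10 Ω, ‖toL2 U‖ ≤ C * ‖grad U‖) (hl : 0 < l)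
    (hAl : ∀ F, l * ‖F‖ ^ 2 ≤ inner ℝ (A F) F) {f w₁ w₂ : L2 Ω} {M₁ M₂ : H10 Ω}
    (hm : Admissible m) (hM₁ : IsComp Ω m w₁ (toL2 M₁)) (hM₂ : IsComp Ω m w₂ (toL2 M₂))
    (h₁ : ∀ v, residual A f w₁ M₁ v = 0) (h₂ : ∀ v, residual A f w₂ M₂ v = 0) :
    w₁ = w₂ := by
  have hd : ∀ v : H10 Ω, inner ℝ ((w₁ - toL2 M₁) - (w₂ - toL2 M₂)) (toL2 v) +
      inner ℝ (A (grad (M₁ - M₂))) (grad v) = 0 := by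
    intro v
    have e1 := h₁ v
    have e2 := h₂ v
    rw [residual_apply] at e1 e2
    rw [grad_sub, map_sub, inner_sub_left, inner_sub_left (A (grad M₁))]
    linarith
  have h3 : 0 ≤ inner ℝ ((w₁ - toL2 M₁) - (w₂ - toL2 M₂)) (toL2 (M₁ - M₂)) := by
    have e1 := hM₁.norm_sq_sub_le hm hM₂
    have e2 : (w₁ - toL2 M₁) - (w₂ - toL2 M₂) = (w₁ - w₂) - (toL2 M₁ - toL2 M₂) := by abel
    rw [toL2_sub, e2, inner_sub_left, real_inner_self_eq_norm_sq,
      real_inner_comm (toL2 M₁ - toL2 M₂) (w₁ - w₂)]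
    linarith
  -- With this test element both terms are non-negative and their sum is zero, so coercivity forces
  -- `∇(M₁ - M₂) = 0`.
  have h4 := hd (M₁ - M₂)
  have h5 := hAl (grad (M₁ - M₂))
  have h6 : grad (M₁ - M₂) = 0 := by
    have : ‖grad (M₁ - M₂)‖ ^ 2 ≤ 0 := by
      by_contra! h
      nlinarith
    exact norm_eq_zero.1 (pow_eq_zero_iff two_ne_zero |>.1 (le_antisymm this (sq_nonneg _)))
  have h7 : toL2 M₁ = toL2 M₂ := by
    have := hC (M₁ - M₂)
    rw [h6, norm_zero, mul_zero, toL2_sub] at this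
    exact sub_eq_zero.1 (norm_le_zero_iff.1 this)
  -- Once the diffusion terms agree, the difference of the `ρ`'s is orthogonal to `H¹₀`, which is
  -- dense in `L²`.
  have h8 : (w₁ - toL2 M₁) - (w₂ - toL2 M₂) = 0 :=
    eq_zero_of_forall_inner_toL2 hΩ fun v => by
      have := hd v
      rw [h6, map_zero, inner_zero_left, add_zero] at this
      exact this
  rw [h7] at h8
  simpa [sub_eq_zero] using h8

/-- If `w_k` converges weakly and `μ(w_k)` converges strongly, the limits are consistent. -/
theorem tendsto_comp_of_tendstoWeakly (hm : Admissible m) {w u : ℕ → L2 Ω} {w' u' : L2 Ω}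
    (hu : ∀ k, IsComp Ω m (w k) (u k)) {B : ℝ} (hB : ∀ k, ‖w k‖ ≤ B)
    (hw : TendstoWeakly w w') (hlim : Tendsto u atTop (𝓝 u')) : IsComp Ω m w' u' := by
  -- Here `p = m(w')`. Then `‖u k - p‖²` is at most the pairing of `u k - p`, strongly convergent,
  -- with `w k - w'`, weakly null, so `u k → p`.
  obtain ⟨p, hp⟩ := exists_isComp w' hm.continuous hm.abs_le
  have h1 : Tendsto (fun k => inner ℝ (w k - w') (u k - p)) atTop (𝓝 (inner ℝ (w' - w') (u' - p))) :=
    (hw.sub (tendstoWeakly_of_tendsto tendsto_const_nhds)).inner (C := B + ‖w'‖)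
      (fun k => (norm_sub_le _ _).trans (by linarith [hB k])) (hlim.sub_const p)
  rw [sub_self, inner_zero_left] at h1
  have h2 : Tendsto (fun k => ‖u k - p‖ ^ 2) atTop (𝓝 0) :=
    squeeze_zero (fun k => by positivity) (fun k => by
      rw [real_inner_comm]
      exact (hu k).norm_sq_sub_le hm hp) h1
  have h3 : Tendsto u atTop (𝓝 p) := by
    rw [tendsto_iff_norm_sub_tendsto_zero]
    simpa using h2.sqrt
  rwa [tendsto_nhds_unique hlim h3]

/-- Limits of solutions of the schemes are weak solutions. -/
theorem residual_eq_zero_of_tendsto {V : ℕ → Submodule ℝ (H10 Ω)} {f w' : L2 Ω} {w : ℕ → L2 Ω}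
    {M : ℕ → H10 Ω} {M' : H10 Ω} {B : ℝ} (hwB : ∀ k, ‖w k‖ ≤ B) (hMB : ∀ k, ‖M k‖ ≤ B)
    (hw : TendstoWeakly w w') (hM : TendstoWeakly M M')
    (h : ∀ k, ∀ v ∈ V k, residual A f (w k) (M k) v = 0) {φ : H10 Ω} {v : ℕ → H10 Ω}
    (hv : ∀ k, v k ∈ V k) (hlim : Tendsto v atTop (𝓝 φ)) : residual A f w' M' φ = 0 := by
  have hv1 : Tendsto (fun k => toL2 (v k)) atTop (𝓝 (toL2 φ)) :=
    ((toL2L Ω).continuous.tendsto _).comp hlim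
  have hv2 : Tendsto (fun k => grad (v k)) atTop (𝓝 (grad φ)) :=
    ((gradL Ω).continuous.tendsto _).comp hlim
  have hM1 : TendstoWeakly (fun k => toL2 (M k)) (toL2 M') := hM.map (toL2L Ω)
  have hM2 : TendstoWeakly (fun k => A (grad (M k))) (A (grad M')) := hM.map (A.comp (gradL Ω))
  have h1 := (hw.sub hM1).inner (C := B + B) (fun k => (norm_sub_le _ _).trans
    (add_le_add (hwB k) ((norm_toL2_le _).trans (hMB k)))) hv1
  have h2 := hM2.inner (C := ‖A‖ * B) (fun k => (A.le_opNorm _).trans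
    (mul_le_mul_of_nonneg_left ((norm_grad_le _).trans (hMB k)) (norm_nonneg _))) hv2
  have h3 : Tendsto (fun k => inner ℝ f (toL2 (v k))) atTop (𝓝 (inner ℝ f (toL2 φ))) :=
    (innerSL ℝ f).continuous.tendsto _ |>.comp hv1
  have h4 := (h1.add h2).sub h3
  rw [residual_apply]
  refine tendsto_nhds_unique h4 (tendsto_const_nhds.congr fun k => ?_)
  have := h k (v k) (hv k)
  rw [residual_apply] at this
  exact this.symm

/-- Approximation by elements of the spaces. -/
theorem exists_tendsto_of_iInf {X : Type*} [NormedAddCommGroup X] [NormedSpace ℝ X]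
    {V : ℕ → Submodule ℝ X} {φ : X}
    (h : Tendsto (fun k => ⨅ v : V k, ‖φ - (v : X)‖) atTop (𝓝 0)) :
    ∃ v : ℕ → X, (∀ k, v k ∈ V k) ∧ Tendsto v atTop (𝓝 φ) := by
  have h1 : ∀ k : ℕ, ∃ v : V k, ‖φ - (v : X)‖ < (⨅ v : V k, ‖φ - (v : X)‖) + 1 / (k + 1) :=
    fun k => exists_lt_of_ciInf_lt (lt_add_of_pos_right _ (by positivity))
  choose v hv using h1
  refine ⟨fun k => v k, fun k => (v k).2, ?_⟩
  rw [tendsto_iff_norm_sub_tendsto_zero]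
  refine squeeze_zero (fun k => norm_nonneg _) (fun k => ?_)
    (by simpa using h.add (tendsto_one_div_add_atTop_nhds_zero_nat (𝕜 := ℝ)))
  rw [norm_sub_rev]
  exact (hv k).le.trans_eq (by rw [one_div])

/-- Compactness: subsequences of solutions of the schemes converge to weak solutions. -/
theorem exists_subseq_scheme [IsFiniteMeasure (volume.restrict Ω)]
    {V : ℕ → Submodule ℝ (H10 Ω)}
    (hV : ∀ φ : H10 Ω, ∃ v : ℕ → H10 Ω, (∀ k, v k ∈ V k) ∧ Tendsto v atTop (𝓝 φ))
    {f : L2 Ω} {w : ℕ → H10 Ω} {B : ℝ} (hwB : ∀ k, ‖toL2 (w k)‖ ≤ B)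
    (hMB : ∀ k, ‖compMu hm (w k)‖ ≤ B)
    (h : ∀ k, ∀ v ∈ V k, residual A f (toL2 (w k)) (compMu hm (w k)) v = 0)
    {k : ℕ → ℕ} (hk : Tendsto k atTop atTop) :
    ∃ (j : ℕ → ℕ) (w' : L2 Ω) (M' : H10 Ω),
      TendstoWeakly (fun n => toL2 (w (k (j n)))) w' ∧
      TendstoWeakly (fun n => compMu hm (w (k (j n)))) M' ∧
      IsComp Ω m w' (toL2 M') ∧ ∀ v, residual A f w' M' v = 0 := by
  have : Fact ((2 : ENNReal) ≠ ⊤) := ⟨by simp⟩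
  obtain ⟨w', j₁, hj₁, hw'⟩ := exists_subseq_tendstoWeakly fun n => hwB (k n)
  obtain ⟨M', j₂, hj₂, hM'⟩ := exists_subseq_tendstoWeakly fun n => hMB (k (j₁ n))
  have hw2 : TendstoWeakly (fun n => toL2 (w (k (j₁ (j₂ n))))) w' := hw'.comp hj₂.tendsto_atTop
  have hj : Tendsto (fun n => k (j₁ (j₂ n))) atTop atTop :=
    hk.comp (hj₁.tendsto_atTop.comp hj₂.tendsto_atTop)
  refine ⟨fun n => j₁ (j₂ n), w', M', hw2, hM', ?_, fun φ => ?_⟩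
  -- Rellich's theorem supplies the strong convergence of `μ(w)` without which the monotonicity
  -- argument could not identify the limit.
  · exact tendsto_comp_of_tendstoWeakly hm (fun n => isComp_compMu hm (w (k (j₁ (j₂ n)))))
      (fun n => hwB _) hw2 (tendsto_toL2_of_tendstoWeakly (fun n => hMB _) hM')
  · obtain ⟨v, hv, hlim⟩ := hV φ
    exact residual_eq_zero_of_tendsto (V := fun n => V (k (j₁ (j₂ n)))) (fun n => hwB _)
      (fun n => hMB _) hw2 hM' (fun n => h _) (v := fun n => v (k (j₁ (j₂ n))))
      (fun n => hv _) (hlim.comp hj)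

theorem inner_sub_add_inner {X : Type*} [NormedAddCommGroup X] [InnerProductSpace ℝ X]
    (a a' b b' : X) :
    inner ℝ ((a - b) - (a' - b')) (a - a') + inner ℝ (a - a') (b - b') = ‖a - a'‖ ^ 2 := by
  rw [real_inner_comm (b - b') (a - a'), ← inner_add_left, ← real_inner_self_eq_norm_sq]
  congr 1
  abel

/-- Strong convergence under the energy equality. -/
theorem tendsto_of_energy (hm : Admissible m) (hl : 0 < l)
    (hAl : ∀ F, l * ‖F‖ ^ 2 ≤ inner ℝ (A F) F) {f w' u' : L2 Ω} {w u : ℕ → L2 Ω}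
    {N : ℕ → L2Vec Ω} {N' : L2Vec Ω} {B : ℝ} (hwB : ∀ k, ‖w k‖ ≤ B)
    (hu : ∀ k, IsComp Ω m (w k) (u k)) (hu' : IsComp Ω m w' u')
    (hw : TendstoWeakly w w') (hul : Tendsto u atTop (𝓝 u')) (hN : TendstoWeakly N N')
    (he : ∀ k, inner ℝ (w k - u k) (w k) + inner ℝ (A (N k)) (N k) = inner ℝ f (w k))
    (he' : inner ℝ (w' - u') w' + inner ℝ (A N') N' = inner ℝ f w') :
    Tendsto N atTop (𝓝 N') ∧ Tendsto w atTop (𝓝 w') := by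
  have hR : TendstoWeakly (fun k => w k - u k) (w' - u') :=
    hw.sub (tendstoWeakly_of_tendsto hul)
  have t1 := hw.clm (innerSL ℝ f)
  have t2 := hR.clm (innerSL ℝ w')
  have t3 := hw.clm (innerSL ℝ (w' - u'))
  have t4 := (hN.map A).clm (innerSL ℝ N')
  have t5 := hN.clm (innerSL ℝ (A N'))
  simp only [innerSL_apply_apply] at t1 t2 t3 t4 t5
  -- Expanding the left side, the two energy equalities replace all terms quadratic in index-`k`
  -- quantities. What remains is affine in `w k`, `u k` and `N k`, so weak convergence suffices to
  -- pass to the limit.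
  have hDE : ∀ k, inner ℝ (A (N k - N')) (N k - N') +
      inner ℝ ((w k - u k) - (w' - u')) (w k - w') =
      inner ℝ f (w k) - inner ℝ w' (w k - u k) - inner ℝ (w' - u') (w k) -
        inner ℝ N' (A (N k)) - inner ℝ (A N') (N k) + inner ℝ f w' := by
    intro k
    rw [← he k, ← he', map_sub, inner_sub_left, inner_sub_right, inner_sub_right,
      inner_sub_left (w k - u k), inner_sub_right (w k - u k), inner_sub_right (w' - u'),
      real_inner_comm w' (w k - u k), real_inner_comm N' (A (N k))]
    ring
  have hlim : Tendsto (fun k => inner ℝ (A (N k - N')) (N k - N') +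
      inner ℝ ((w k - u k) - (w' - u')) (w k - w')) atTop (𝓝 0) := by
    simp_rw [hDE]
    have := ((((t1.sub t2).sub t3).sub t4).sub t5).add_const (inner ℝ f w')
    convert this using 2
    rw [← he', real_inner_comm w' (w' - u'), real_inner_comm N' (A N')]
    ring
  have hD : ∀ k, 0 ≤ inner ℝ (A (N k - N')) (N k - N') := fun k =>
    le_trans (by positivity) (hAl _)
  have hE : ∀ k, 0 ≤ inner ℝ ((w k - u k) - (w' - u')) (w k - w') := fun k =>
    (hu k).inner_rho_nonneg hm hu'
  constructor
  · have h1 : Tendsto (fun k => ‖N k - N'‖ ^ 2) atTop (𝓝 0) := by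
      refine squeeze_zero (fun k => by positivity) (fun k => ?_) (zero_div l ▸ hlim.div_const l)
      rw [le_div_iff₀ hl]
      linarith [hAl (N k - N'), hE k]
    rw [tendsto_iff_norm_sub_tendsto_zero]
    simpa using h1.sqrt
  -- `‖w k - w'‖²` is the `ρ` part of the vanishing sum plus `(w k - w', u k - u')`, and the latter
  -- is a weak-strong pairing.
  · have h2 : Tendsto (fun k => inner ℝ (w k - w') (u k - u')) atTop
        (𝓝 (inner ℝ (w' - w') (u' - u'))) :=
      (hw.sub (tendstoWeakly_of_tendsto tendsto_const_nhds)).inner (C := B + ‖w'‖)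
        (fun k => (norm_sub_le _ _).trans (by linarith [hwB k])) (hul.sub_const u')
    rw [sub_self, inner_zero_left] at h2
    have h3 : Tendsto (fun k => ‖w k - w'‖ ^ 2) atTop (𝓝 0) := by
      refine squeeze_zero (fun k => by positivity) (fun k => ?_) (add_zero (0 : ℝ) ▸ hlim.add h2)
      have e1 := inner_sub_add_inner (w k) w' (u k) u'
      linarith [hD k]
    rw [tendsto_iff_norm_sub_tendsto_zero]
    simpa using h3.sqrt

end DegenElliptic

/-! ### Convergence of the full sequence and the main theorem -/

namespace DegenElliptic

variable {d : ℕ} {Ω : Set (Space d)} {m : ℝ → ℝ} (hm : Admissible m)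
  {A : L2Vec Ω →L[ℝ] L2Vec Ω} {l C : ℝ}

/-- Convergence of the solutions of the schemes towards a weak solution. -/
theorem tendsto_scheme [IsFiniteMeasure (volume.restrict Ω)] (hΩ : IsOpen Ω) (hC0 : 0 < C)
    (hC : ∀ U : H10 Ω, ‖toL2 U‖ ≤ C * ‖grad U‖) (hl : 0 < l)
    (hAl : ∀ F, l * ‖F‖ ^ 2 ≤ inner ℝ (A F) F)
    (hA : ∀ w : H10 Ω, inner ℝ (A (grad (compMu hm w))) (grad w) =
      inner ℝ (A (grad (compNu hm w))) (grad (compNu hm w)))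
    {V : ℕ → Submodule ℝ (H10 Ω)}
    (hV : ∀ φ : H10 Ω, ∃ v : ℕ → H10 Ω, (∀ k, v k ∈ V k) ∧ Tendsto v atTop (𝓝 φ))
    {f w' : L2 Ω} {M' : H10 Ω} {w : ℕ → H10 Ω} (hM' : IsComp Ω m w' (toL2 M'))
    (h' : ∀ v, residual A f w' M' v = 0) (hwV : ∀ k, w k ∈ V k)
    (h : ∀ k, ∀ v ∈ V k, residual A f (toL2 (w k)) (compMu hm (w k)) v = 0) :
    (∃ B, ∀ k, ‖toL2 (w k)‖ ≤ B) ∧ TendstoWeakly (fun k => toL2 (w k)) w' ∧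
      TendstoWeakly (fun k => compMu hm (w k)) M' ∧
      Tendsto (fun k => toL2 (compMu hm (w k))) atTop (𝓝 (toL2 M')) ∧
      ∃ N' : H10 Ω, IsComp Ω (sqrtPrim m) w' (toL2 N') ∧
        TendstoWeakly (fun k => compNu hm (w k)) N' ∧
        Tendsto (fun k => toL2 (compNu hm (w k))) atTop (𝓝 (toL2 N')) := by
  obtain ⟨B, hB⟩ := exists_bound hm hC0 hC hl hAl hA f
  have hB' := fun k => hB (w k) (h k _ (hwV k))
  have hsub : ∀ k : ℕ → ℕ, Tendsto k atTop atTop → ∃ j : ℕ → ℕ,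
      TendstoWeakly (fun n => toL2 (w (k (j n)))) w' ∧
      TendstoWeakly (fun n => compMu hm (w (k (j n)))) M' := by
    intro k hk
    obtain ⟨j, w₂, M₂, e1, e2, e3, e4⟩ := exists_subseq_scheme hm hV (fun n => (hB' n).1)
      (fun n => (hB' n).2.1) h hk
    -- Uniqueness gives every subsequence the same limit, so no further extraction is needed for the
    -- whole sequence.
    have e5 : w₂ = w' := weak_unique hΩ hC hl hAl hm e3 hM' e4 h'
    subst e5
    have e6 : M₂ = M' := toL2_injective hΩ (e3.eq hM')
    subst e6
    exact ⟨j, e1, e2⟩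
  have hw : TendstoWeakly (fun k => toL2 (w k)) w' := tendstoWeakly_of_subseq fun k hk =>
    (hsub k hk).imp fun _ h => h.1
  have hM : TendstoWeakly (fun k => compMu hm (w k)) M' := tendstoWeakly_of_subseq fun k hk =>
    (hsub k hk).imp fun _ h => h.2
  have hMs := tendsto_toL2_of_tendstoWeakly (fun k => (hB' k).2.1) hM
  obtain ⟨n, hn⟩ := exists_isComp w' hm.continuous_sqrtPrim hm.abs_sqrtPrim_le
  have hN : Tendsto (fun k => toL2 (compNu hm (w k))) atTop (𝓝 n) := by
    have h1 : Tendsto (fun k => inner ℝ (toL2 (w k) - w') (toL2 (compMu hm (w k)) - toL2 M')) atTop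
        (𝓝 (inner ℝ (w' - w') (toL2 M' - toL2 M'))) :=
      (hw.sub (tendstoWeakly_of_tendsto tendsto_const_nhds)).inner (C := B + ‖w'‖)
        (fun k => (norm_sub_le _ _).trans (by linarith [(hB' k).1])) (hMs.sub_const (toL2 M'))
    rw [sub_self, inner_zero_left] at h1
    have h2 : Tendsto (fun k => ‖toL2 (compNu hm (w k)) - n‖ ^ 2) atTop (𝓝 0) :=
      squeeze_zero (fun k => by positivity) (fun k =>
        (isComp_compMu hm (w k)).norm_sq_sqrtPrim_sub_le hm hM' (isComp_compNu hm (w k)) hn) h1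
    rw [tendsto_iff_norm_sub_tendsto_zero]
    simpa using h2.sqrt
  -- Here `w'` is only in `L²`, so the chain rule does not apply to it. That `ν(w')` belongs to
  -- `H¹₀` comes from the uniform bound on the approximations.
  obtain ⟨N', rfl⟩ := exists_toL2_eq_of_tendstoWeakly (fun k => (hB' k).2.2)
    (tendstoWeakly_of_tendsto hN)
  exact ⟨⟨B, fun k => (hB' k).1⟩, hw, hM, hMs, N', hn,
    tendstoWeakly_of_toL2 hΩ (fun k => (hB' k).2.2) (tendstoWeakly_of_tendsto hN), hN⟩

/-- Existence of a weak solution, as a limit of solutions of the schemes. -/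
theorem exists_weak [IsFiniteMeasure (volume.restrict Ω)] (hC0 : 0 < C)
    (hC : ∀ U : H10 Ω, ‖toL2 U‖ ≤ C * ‖grad U‖) (hl : 0 < l)
    (hAl : ∀ F, l * ‖F‖ ^ 2 ≤ inner ℝ (A F) F)
    (hA : ∀ w : H10 Ω, inner ℝ (A (grad (compMu hm w))) (grad w) =
      inner ℝ (A (grad (compNu hm w))) (grad (compNu hm w)))
    {V : ℕ → Submodule ℝ (H10 Ω)}
    (hV : ∀ φ : H10 Ω, ∃ v : ℕ → H10 Ω, (∀ k, v k ∈ V k) ∧ Tendsto v atTop (𝓝 φ)) {f : L2 Ω}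
    (hex : ∀ k, ∃ w ∈ V k, ∀ v ∈ V k, residual A f (toL2 w) (compMu hm w) v = 0) :
    ∃ (w' : L2 Ω) (M' : H10 Ω), IsComp Ω m w' (toL2 M') ∧ ∀ v, residual A f w' M' v = 0 := by
  choose w hwV hw using hex
  obtain ⟨B, hB⟩ := exists_bound hm hC0 hC hl hAl hA f
  have hB' := fun k => hB (w k) (hw k _ (hwV k))
  obtain ⟨j, w', M', -, -, hM', h'⟩ := exists_subseq_scheme hm hV (fun k => (hB' k).1)
    (fun k => (hB' k).2.1) hw tendsto_id
  exact ⟨w', M', hM', h'⟩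

theorem diffusion_eq {Λ : Space d → Matrix (Fin d) (Fin d) ℝ}
    (hA : ∀ F, ∀ᵐ x ∂(volume.restrict Ω), A F x = Matrix.toEuclideanLin (Λ x) (F x))
    (U W : H10 Ω) : diffusion Ω Λ U W = inner ℝ (A (grad U)) (grad W) := by
  rw [L2.inner_def]
  refine integral_congr_ae ?_
  filter_upwards [hA (grad U)] with x e
  rw [e]

theorem isComp_rho {β ζ : ℝ → ℝ} {w u : L2 Ω} (h : IsComp Ω (mu β ζ) w u) :
    IsComp Ω (rho β ζ) w (w - u) := by
  filter_upwards [h, Lp.coeFn_sub w u] with x e1 e2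
  rw [e2, Pi.sub_apply, e1, rho]

theorem integral_rho_mul {β ζ : ℝ → ℝ} {w u : L2 Ω} (h : IsComp Ω (mu β ζ) w u) (v : L2 Ω) :
    ∫ x in Ω, rho β ζ (w x) * v x = inner ℝ (w - u) v := by
  rw [inner_L2_eq]
  refine integral_congr_ae ?_
  filter_upwards [isComp_rho h] with x e
  rw [e]

theorem solvesAgainst_iff {Λ : Space d → Matrix (Fin d) (Fin d) ℝ}
    (hA : ∀ F, ∀ᵐ x ∂(volume.restrict Ω), A F x = Matrix.toEuclideanLin (Λ x) (F x))
    {f w : L2 Ω} {β ζ : ℝ → ℝ} {T : Submodule ℝ (H10 Ω)} :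
    SolvesAgainst Ω Λ f β ζ T w ↔
      ∃ M : H10 Ω, IsComp Ω (mu β ζ) w (toL2 M) ∧ ∀ v ∈ T, residual A f w M v = 0 := by
  refine exists_congr fun M => and_congr_right fun hM => forall₂_congr fun v _ => ?_
  rw [integral_rho_mul hM, diffusion_eq hA, ← inner_L2_eq, residual_apply, sub_eq_zero]

/-- The `H¹₀` representative of `μ(w)` is unique, so it must be `compMu hm w`. The estimates
therefore apply to arbitrary scheme solutions. -/
theorem isSchemeSolution_iff [IsFiniteMeasure (volume.restrict Ω)] (hΩ : IsOpen Ω)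
    {Λ : Space d → Matrix (Fin d) (Fin d) ℝ}
    (hA : ∀ F, ∀ᵐ x ∂(volume.restrict Ω), A F x = Matrix.toEuclideanLin (Λ x) (F x))
    {f : L2 Ω} {β ζ : ℝ → ℝ} (hm : Admissible (mu β ζ)) {V : Submodule ℝ (H10 Ω)} {w : H10 Ω} :
    IsSchemeSolution Ω Λ f β ζ V w ↔
      w ∈ V ∧ ∀ v ∈ V, residual A f (toL2 w) (compMu hm w) v = 0 := by
  refine and_congr_right fun _ => ?_
  rw [solvesAgainst_iff hA]
  constructor
  · rintro ⟨M, hM, h⟩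
    have e : M = compMu hm w := toL2_injective hΩ (hM.eq (isComp_compMu hm w))
    subst e
    exact h
  · exact fun h => ⟨compMu hm w, isComp_compMu hm w, h⟩

theorem isWeakSolution_iff {Λ : Space d → Matrix (Fin d) (Fin d) ℝ}
    (hA : ∀ F, ∀ᵐ x ∂(volume.restrict Ω), A F x = Matrix.toEuclideanLin (Λ x) (F x))
    {f w : L2 Ω} {β ζ : ℝ → ℝ} :
    IsWeakSolution Ω Λ f β ζ w ↔
      ∃ M : H10 Ω, IsComp Ω (mu β ζ) w (toL2 M) ∧ ∀ v, residual A f w M v = 0 := by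
  rw [IsWeakSolution, solvesAgainst_iff hA]
  simp only [Submodule.mem_top, forall_const]

end DegenElliptic

end

open DegenElliptic

set_option maxHeartbeats 1000000 in
theorem mainTheorem7 (d : ℕ) (hd : 0 < d)
    (Ω : Set (Space d)) (hΩo : IsOpen Ω) (hΩb : Bornology.IsBounded Ω) (hΩc : IsConnected Ω)
    (ζ β : ℝ → ℝ)
    (hζ : Continuous ζ) (hζm : Monotone ζ) (hζ0 : ζ 0 = 0)
    (hζg : ∃ M₀ > 0, ∃ M₁ > 0, ∀ s : ℝ, M₀ * |s| - M₁ ≤ |ζ s|)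
    (hβ : Continuous β) (hβm : Monotone β) (hβ0 : β 0 = 0)
    (hβg : ∃ K₀ > 0, ∃ K₁ > 0, ∀ s : ℝ, |β s| ≤ K₀ * |s| + K₁)
    (hinc : StrictMono fun s => β s + ζ s)
    (Λ : Space d → Matrix (Fin d) (Fin d) ℝ)
    (hΛm : ∀ i j, AEMeasurable (fun x => Λ x i j) (volume.restrict Ω))
    (hΛ : ∃ lmin lmax : ℝ, 0 < lmin ∧ lmin ≤ lmax ∧ ∀ᵐ x ∂(volume.restrict Ω),
      (Λ x).IsSymm ∧
        ∀ l : ℝ, Module.End.HasEigenvalue (Matrix.toLin' (Λ x)) l → l ∈ Set.Icc lmin lmax)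
    (f : L2 Ω)
    (V : ℕ → Submodule ℝ (H10 Ω)) (hVfin : ∀ m, FiniteDimensional ℝ (V m))
    (hV : ∀ φ : H10 Ω, Tendsto (fun m => ⨅ v : V m, ‖φ - (v : H10 Ω)‖) atTop (𝓝 0)) :
    (∀ m, ∃ w : H10 Ω, IsSchemeSolution Ω Λ f β ζ (V m) w) ∧
    (∃! w' : L2 Ω, IsWeakSolution Ω Λ f β ζ w') ∧
    ∀ w' : L2 Ω, IsWeakSolution Ω Λ f β ζ w' →
    ∀ w : ℕ → H10 Ω, (∀ m, IsSchemeSolution Ω Λ f β ζ (V m) (w m)) →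
      ∃ (M N : ℕ → H10 Ω) (M' N' : H10 Ω) (R : ℕ → L2 Ω) (R' : L2 Ω),
        (∀ m, IsComp Ω (mu β ζ) (toL2 (w m)) (toL2 (M m))) ∧
        IsComp Ω (mu β ζ) w' (toL2 M') ∧
        (∀ m, IsComp Ω (nu β ζ) (toL2 (w m)) (toL2 (N m))) ∧
        IsComp Ω (nu β ζ) w' (toL2 N') ∧
        (∀ m, IsComp Ω (rho β ζ) (toL2 (w m)) (R m)) ∧
        IsComp Ω (rho β ζ) w' R' ∧
        TendstoWeakly M M' ∧ Tendsto (fun m => toL2 (M m)) atTop (𝓝 (toL2 M')) ∧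
        TendstoWeakly N N' ∧ Tendsto (fun m => toL2 (N m)) atTop (𝓝 (toL2 N')) ∧
        TendstoWeakly R R' ∧
        ((∫ x in Ω, rho β ζ (w' x) * w' x) + diffusion Ω Λ N' N' = ∫ x in Ω, f x * w' x →
          Tendsto (fun m => grad (N m)) atTop (𝓝 (grad N')) ∧
          Tendsto (fun m => toL2 (w m)) atTop (𝓝 w')) := by
  have hfin : IsFiniteMeasure (volume.restrict Ω) :=
    ⟨by rw [Measure.restrict_apply_univ]; exact hΩb.measure_lt_top⟩
  obtain ⟨C, hC0, hC⟩ := exists_poincare hd hΩo hΩb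
  obtain ⟨A, l, hl, hA, hAl⟩ := exists_diffusion_operator hΛm hΛ
  have hm := admissible_mu β ζ hζ hζm hζ0 hζg hβ hβm hβ0 hβg hinc
  have hAm := inner_diffusion_compMu hm hA
  have hV' := fun φ => exists_tendsto_of_iInf (hV φ)
  have hex : ∀ k, ∃ w : H10 Ω, IsSchemeSolution Ω Λ f β ζ (V k) w := fun k => by
    have := hVfin k
    obtain ⟨w, hw⟩ := exists_scheme hm hΩo hC0 hC hl hAl hAm f (V k)
    exact ⟨w, (isSchemeSolution_iff hΩo hA hm).2 hw⟩
  refine ⟨hex, ?_, fun w' hw' w hw => ?_⟩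
  · obtain ⟨w', M', hM', h'⟩ := exists_weak hm hC0 hC hl hAl hAm hV' fun k =>
      (hex k).imp fun w hw => (isSchemeSolution_iff hΩo hA hm).1 hw
    refine ⟨w', (isWeakSolution_iff hA).2 ⟨M', hM', h'⟩, fun w₂ hw₂ => ?_⟩
    obtain ⟨M₂, hM₂, h₂⟩ := (isWeakSolution_iff hA).1 hw₂
    exact weak_unique hΩo hC hl hAl hm hM₂ hM' h₂ h'
  · obtain ⟨M', hM', h'⟩ := (isWeakSolution_iff hA).1 hw'
    replace hw := fun k => (isSchemeSolution_iff hΩo hA hm).1 (hw k)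
    obtain ⟨⟨B, hB⟩, hww, hM, hMs, N', hN', hN, hNs⟩ := tendsto_scheme hm hΩo hC0 hC hl hAl hAm hV'
      hM' h' (fun k => (hw k).1) (fun k => (hw k).2)
    -- The statements about `nu β ζ` are those about `sqrtPrim (mu β ζ)`, the two being
    -- definitionally equal.
    refine ⟨fun k => compMu hm (w k), fun k => compNu hm (w k), M', N',
      fun k => toL2 (w k) - toL2 (compMu hm (w k)), w' - toL2 M', fun k => isComp_compMu hm (w k),
      hM', fun k => isComp_compNu hm (w k), hN', fun k => isComp_rho (isComp_compMu hm (w k)),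
      isComp_rho hM', hM, hMs, hN, hNs, hww.sub (hM.map (toL2L Ω)), fun he => ?_⟩
    rw [integral_rho_mul hM', diffusion_eq hA, ← inner_L2_eq] at he
    have hg : TendstoWeakly (fun k => grad (compNu hm (w k))) (grad N') := hN.map (gradL Ω)
    -- The discrete energy equality holds unconditionally, by testing with `w k ∈ V k`.
    have hek : ∀ k, inner ℝ (toL2 (w k) - toL2 (compMu hm (w k))) (toL2 (w k)) +
        inner ℝ (A (grad (compNu hm (w k)))) (grad (compNu hm (w k))) =
          inner ℝ f (toL2 (w k)) := fun k => by
      have h1 := (hw k).2 _ (hw k).1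
      rw [residual_apply, hAm] at h1
      exact sub_eq_zero.1 h1
    exact tendsto_of_energy hm hl hAl hB (fun k => isComp_compMu hm (w k)) hM' hww hMs hg hek he
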